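/- Let $k,n$ be non-negative integers. For $\ell\in\mathbb Z^k$ put $T_\ell f(x)=f(x-\ell)$ on $L^2(\mathbb R^k)$, and for $\mathcal F=\{f_i\}_{i=1}^n\subset L^2(\mathbb R^k)$ let $E(\mathcal F)=\{T_\ell f_i\}_{(\ell,i)\in\mathbb Z^k\times\{1,\dots,n\}}$. Let $\mathcal V,\mathcal W\subseteq L^2(\mathbb R^k)$ be finitely generated shift-invariant closed subspaces (each is the closed linear span of all integer translates of a finite set) such that $L^2(\mathbb R^k)=\mathcal V\oplus\mathcal W^\perp$ (algebraic direct sum), let $\mathcal F=\{f_i\}_{i=1}^n\subset\mathcal W$ be such that $E(\mathcal F)$ is a frame for $\mathcal W$, and let $c\in\mathbb R$. For a Bessel sequence $\mathcal H=\{h_j\}_j$ let $T_{\mathcal H}:\ell^2\to L^2(\mathbb R^k)$, $T_{\mathcal H}(a)=\sum_j a_jh_j$, and let $S_{\mathcal H}=T_{\mathcal H}T_{\mathcal H}^*$ be its frame operator. Let $P_{\mathcal V}$ be the orthogonal projection onto $\mathcal V$. A shift-generated oblique $\mathcal V$-dual of $E(\mathcal F)$ is a Bessel sequence $E(\mathcal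 G)$, with $\mathcal G=\{g_i\}_{i=1}^n\subset\mathcal V$, such that $$f=\sum_{(\ell,i)}\langle f,T_\ell g_i\rangle\,T_\ell f_i\qquad\text{for all } f\in\mathcal W;$$ it is $c$-tight if $S_{E(\mathcal G)}=c\,P_{\mathcal V}$. The canonical $\mathcal V$-dual of $E(\mathcal F)$ is $$E(\mathcal F)^\#_{\mathcal V}=\{P_{\mathcal V/\!/\mathcal W^\perp}S_{E(\mathcal F)}^\dagger T_\ell f_i\}_{(\ell,i)},$$ where $\dagger$ is the Moore-Penrose pseudo-inverse and $P_{\mathcal V/\!/\mathcal W^\perp}$ is the projection with range $\mathcal V$ and kernel $\mathcal W^\perp$. Let $\mathbb T=[-\tfrac12,\tfrac12)$ and $\Gamma f(x)=(\hat f(x+\ell))_{\ell\in\mathbb Z^k}\in\ell^2(\mathbb Z^k)$ for $f\in L^2(\mathbb R^k)$ and a.e. $x\in\mathbb T^k$. Let $J_{\mathcal V}$ be the measurable range function of $\mathcal V$, i.e. the (a.e. unique) weakly measurable field of closed subspaces $J_{\mathcal V}(x)\subseteq\ell^2(\mathbb Z^k)$ with $\mathcal V=\{f:\Gamma f(x)\in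 J_{\mathcal V}(x)\text{ for a.e. }x\in\mathbb T^k\}$; put $d(x)=\dim J_{\mathcal V}(x)$ (which is at most $n$ for a.e. $x$) and $\mathrm{Spec}(\mathcal V)=\{x\in\mathbb T^k: J_{\mathcal V}(x)\ne 0\}$. For a bounded operator $S$ on $L^2(\mathbb R^k)$ commuting with all $T_\ell$, let $x\mapsto[S]_x$ be the (a.e. unique) weakly measurable, essentially bounded field of operators on $\ell^2(\mathbb Z^k)$ with $[S]_x\,\Gamma f(x)=\Gamma(Sf)(x)$ for a.e. $x\in\mathbb T^k$, for every $f$. Then there exists a $c$-tight shift-generated oblique $\mathcal V$-dual $E(\mathcal G)$ of $E(\mathcal F)$ if and only if 1. $S_{E(\mathcal F)^\#_{\mathcal V}}\le c\,P_{\mathcal V}$, and 2. $\operatorname{rank}\big([c\,P_{\mathcal V}-S_{E(\mathcal F)^\#_{\mathcal V}}]_x\big)\le\min\{d(x),\,n-d(x)\}$ for a.e. $x\in\mathrm{Spec}(\mathcal V)$. -/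

import Mathlib

open MeasureTheory
open scoped FourierTransform

noncomputable section

namespace ObliqueDuals

/-! ### Frames, oblique duals and frame operators in a Hilbert space

The bracket `⟨f, g⟩`, linear in `f`, is `inner ℂ g f`. -/

/-- `ℓ²(ι)`. -/
abbrev ell2 (ι : Type) : Type := lp (fun _ : ι => ℂ) 2

section Hilbert

variable {H : Type*} [NormedAddCommGroup H] [InnerProductSpace ℂ H] [CompleteSpace H]
variable {ι : Type}

/-- `f` is a Bessel sequence in `H`: `∑ |⟨h, f i⟩|² ≤ b ‖h‖²` for all `h`. -/
def IsBessel (f : ι → H) : Prop :=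
  ∃ b : ℝ, 0 < b ∧ ∀ h : H, Summable (fun i => ‖inner ℂ (f i) h‖ ^ 2) ∧
    ∑' i, ‖inner ℂ (f i) h‖ ^ 2 ≤ b * ‖h‖ ^ 2

/-- `f` is a sequence in `W` that is a frame for the closed subspace `W`. -/
def IsFrameFor (W : ClosedSubmodule ℂ H) (f : ι → H) : Prop :=
  (∀ i, f i ∈ W) ∧ ∃ a b : ℝ, 0 < a ∧ a ≤ b ∧ ∀ h ∈ W,
    Summable (fun i => ‖inner ℂ (f i) h‖ ^ 2) ∧
    a * ‖h‖ ^ 2 ≤ ∑' i, ‖inner ℂ (f i) h‖ ^ 2 ∧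
    ∑' i, ‖inner ℂ (f i) h‖ ^ 2 ≤ b * ‖h‖ ^ 2

/-- `g` is an oblique `V`-dual of the frame `f` for `W`: a Bessel sequence in `V` with
`h = ∑ ⟨h, g i⟩ f i` for all `h ∈ W`. -/
def IsObliqueDual (V W : ClosedSubmodule ℂ H) (f g : ι → H) : Prop :=
  (∀ i, g i ∈ V) ∧ IsBessel g ∧ ∀ h ∈ W, HasSum (fun i => inner ℂ (g i) h • f i) h

open Classical in
/-- The synthesis operator `T_f : ℓ²(ι) → H`, `T_f a = ∑ a i • f i`, of a Bessel sequence
(the value is `0` if there is no such bounded operator, i.e. if `f` is not Bessel). -/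
def synthesis (f : ι → H) : ell2 ι →L[ℂ] H :=
  if h : ∃ T : ell2 ι →L[ℂ] H, ∀ a : ell2 ι, HasSum (fun i => a i • f i) (T a) then
    h.choose
  else 0

/-- The frame operator `S_f = T_f T_f^*`. -/
def frameOperator (f : ι → H) : H →L[ℂ] H :=
  synthesis f ∘L ContinuousLinearMap.adjoint (synthesis f)

/-- `B` is the Moore-Penrose pseudo-inverse of `A`. -/
def IsMoorePenrose (A B : H →L[ℂ] H) : Prop :=
  A ∘L B ∘L A = A ∧ B ∘L A ∘L B = B ∧ IsSelfAdjoint (A ∘L B) ∧ IsSelfAdjoint (B ∘L A)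

open Classical in
/-- The Moore-Penrose pseudo-inverse of a bounded operator (it exists iff the range is closed;
otherwise the value is `0`). -/
def pseudoInverse (A : H →L[ℂ] H) : H →L[ℂ] H :=
  if h : ∃ B, IsMoorePenrose A B then h.choose else 0

/-- The canonical dual `f^# i = S_f^† (f i)`. -/
def canonicalDual (f : ι → H) : ι → H :=
  fun i => pseudoInverse (frameOperator f) (f i)

/-- The canonical `V`-dual `f^#_V i = P_{V // Wᗮ} (f^# i)`, where `P_{V // Wᗮ}` is the oblique
projection with range `V` and kernel `Wᗮ`. -/
def canonicalObliqueDual (V W : ClosedSubmodule ℂ H)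
    (hVW : IsCompl V.toSubmodule W.toSubmoduleᗮ) (f : ι → H) : ι → H :=
  fun i => Submodule.projection V.toSubmodule W.toSubmoduleᗮ hVW (canonicalDual f i)

/-- The orthogonal projection `P_V` as a bounded operator on the whole space. -/
def orthProj (V : ClosedSubmodule ℂ H) : H →L[ℂ] H :=
  V.toSubmodule.starProjection

end Hilbert

/-! ### Shift-invariant subspaces of `L²(ℝᵏ)` and their fibers -/

/-- `ℝᵏ`. -/
abbrev Rk (k : ℕ) : Type := EuclideanSpace ℝ (Fin k)

/-- `L²(ℝᵏ)`, with complex values. -/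
abbrev L2 (k : ℕ) : Type := Lp ℂ 2 (volume : Measure (Rk k))

/-- An element of `ℤᵏ` as a vector of `ℝᵏ`. -/
def latticeVec {k : ℕ} (l : Fin k → ℤ) : Rk k := WithLp.toLp 2 (fun i => (l i : ℝ))

/-- The translate `T_l f (x) = f (x - l)`, for `l ∈ ℤᵏ`. -/
def translate {k : ℕ} (l : Fin k → ℤ) (f : L2 k) : L2 k :=
  Lp.compMeasurePreserving (fun x : Rk k => x - latticeVec l)
    (measurePreserving_sub_right volume (latticeVec l)) f

/-- The family `E(F)` of all integer translates of `F`. -/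
def translates {k n : ℕ} (F : Fin n → L2 k) : (Fin k → ℤ) × Fin n → L2 k :=
  fun p => translate p.1 (F p.2)

/-- The shift-invariant subspace generated by `A`. -/
def shiftSpan {k : ℕ} (A : Set (L2 k)) : ClosedSubmodule ℂ (L2 k) :=
  (Submodule.span ℂ {g | ∃ f ∈ A, ∃ l : Fin k → ℤ, g = translate l f}).closure

/-- Finitely generated shift-invariant subspaces. -/
def IsFSI {k : ℕ} (V : ClosedSubmodule ℂ (L2 k)) : Prop :=
  ∃ A : Set (L2 k), A.Finite ∧ V = shiftSpan A

/-- The cube `[-1/2, 1/2)ᵏ`. -/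
def torus (k : ℕ) : Set (Rk k) := {x | ∀ i, x i ∈ Set.Ico (-(1 / 2) : ℝ) (1 / 2)}

/-- Lebesgue measure on the cube `[-1/2, 1/2)ᵏ`. -/
def torusMeasure (k : ℕ) : Measure (Rk k) := volume.restrict (torus k)

/-- The space `ℓ²(ℤᵏ)`. -/
abbrev FiberSpace (k : ℕ) : Type := ell2 (Fin k → ℤ)

open Classical in
/-- `Γ f (x) = (f̂ (x + l))_{l ∈ ℤᵏ}`, where `f̂` is the `L²` Fourier transform; for almost every `x`
the sequence is in `ℓ²(ℤᵏ)`, and `Γ f (x)` is set to `0` at the other points. -/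
def fiber {k : ℕ} (f : L2 k) (x : Rk k) : FiberSpace k :=
  if h : Memℓp (fun l : Fin k → ℤ => (𝓕 f : L2 k) (x + latticeVec l)) 2 then
    ⟨fun l => (𝓕 f : L2 k) (x + latticeVec l), h⟩
  else 0

/-- `J` is a measurable range function with
`V = {f | Γ f (x) ∈ J x for a.e. x in the cube}`. -/
def IsRangeFunction {k : ℕ} (V : ClosedSubmodule ℂ (L2 k))
    (J : Rk k → ClosedSubmodule ℂ (FiberSpace k)) : Prop :=
  (∀ ξ η : FiberSpace k,
    AEMeasurable (fun x => inner ℂ η (orthProj (J x) ξ)) (torusMeasure k)) ∧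
  ∀ f : L2 k, f ∈ V ↔ ∀ᵐ x ∂torusMeasure k, fiber f x ∈ J x

open Classical in
/-- The measurable range function `J_V` of a shift-invariant subspace `V`; it exists and is
unique up to null sets in the cube. -/
def rangeFunction {k : ℕ} (V : ClosedSubmodule ℂ (L2 k)) :
    Rk k → ClosedSubmodule ℂ (FiberSpace k) :=
  if h : ∃ J, IsRangeFunction V J then h.choose else fun _ => ⊥

/-- `d(x) = dim J_V(x)`. -/
def fiberDim {k : ℕ} (V : ClosedSubmodule ℂ (L2 k)) (x : Rk k) : ℕ :=
  Module.finrank ℂ (rangeFunction V x).toSubmodule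

/-- `Spec(V) = {x in the cube | J_V(x) ≠ 0}`. -/
def spec {k : ℕ} (V : ClosedSubmodule ℂ (L2 k)) : Set (Rk k) :=
  {x | x ∈ torus k ∧ rangeFunction V x ≠ ⊥}

/-- `s` is a weakly measurable, essentially bounded field of operators on `ℓ²(ℤᵏ)` over the cube
with `s x (Γ f (x)) = Γ (S f) (x)` for a.e. `x`, for every `f`. -/
def IsFiberField {k : ℕ} (S : L2 k →L[ℂ] L2 k)
    (s : Rk k → FiberSpace k →L[ℂ] FiberSpace k) : Prop :=
  (∀ ξ η : FiberSpace k, AEMeasurable (fun x => inner ℂ η (s x ξ)) (torusMeasure k)) ∧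
  (∃ C : ℝ, ∀ᵐ x ∂torusMeasure k, ‖s x‖ ≤ C) ∧
  ∀ f : L2 k, ∀ᵐ x ∂torusMeasure k, s x (fiber f x) = fiber (S f) x

open Classical in
/-- The field `x ↦ [S]_x` of a shift-preserving operator `S`; it exists and is unique up to
null sets in the cube. -/
def fiberOperator {k : ℕ} (S : L2 k →L[ℂ] L2 k) :
    Rk k → FiberSpace k →L[ℂ] FiberSpace k :=
  if h : ∃ s, IsFiberField S s then h.choose else 0

/-- `E(G)` is a shift-generated oblique `V`-dual of the frame `E(F)` for `W`. -/
def IsSGDual {k n : ℕ} (V W : ClosedSubmodule ℂ (L2 k)) (F G : Fin n → L2 k) : Prop :=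
  (∀ i, G i ∈ V) ∧ IsObliqueDual V W (translates F) (translates G)

/-- `E(G)` is `c`-tight for `V`: its frame operator is `c • P_V`. -/
def IsTight {k n : ℕ} (V : ClosedSubmodule ℂ (L2 k)) (c : ℝ) (G : Fin n → L2 k) : Prop :=
  frameOperator (translates G) = (c : ℂ) • orthProj V

end ObliqueDuals

end

/-! Let `Q` be the oblique projection onto `V` along `Wᗮ`, and `φ i = Q S† (F i)`. All operators
involved commute with translations, so `E(φ)` is the canonical `V`-dual. A shift-generated family
`G` in `V` is an oblique dual exactly when `T_G T_F* = Q`. Hence the duals are the `G = φ - r` with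
`r` in `V` and `T_r T_F* = 0`. Since `T_φ = L T_F` for a bounded `L`, also `T_r T_φ* = 0`; the cross
terms vanish and `S_G = S_φ + S_r`. So `G` is `c`-tight iff `S_r = A`, where `A = c P_V - S_φ`, and
the question is when `A` is the frame operator of such an `r`.

Fiberization makes this a finite problem at almost every `x`: `T_G T_H*` acts on fibers as `∑ ⟨·, H
i(x)⟩ G i(x)` (`isFiberField_mixedOperator`). One needs `r i(x)` in `J_V(x)` with `∑ ⟨·, r i(x)⟩ r
i(x) = A(x)` and `∑ ⟨·, F i(x)⟩ r i(x) = 0`. The second equation says that synthesis by `r(x)` kills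
the coefficient vectors `(⟨ξ, F i(x)⟩)_i`. They form a subspace of `ℂⁿ` of dimension `d(x)`, because
`Q` matches the fibers of `W` with those of `V`. So `A(x)` is positive of rank at most `n - d(x)`;
rank at most `d(x)` is automatic, as its range lies in `J_V(x)` (`rank_pairOp_self_le`).

Conversely, let `N` be the matrix of `A(x)` in the frame coordinates given by `φ` and its dual `θ =
P_V F`, and `K` the projection of `ℂⁿ` onto the complement of those coefficient vectors. If `rank N
≤ rank K` there is `M` with `M Mᴴ = N` and `M K = M`; its columns are the coefficients of `r(x)`
(`pairOp_combine_factor`). The choice of `M` must be measurable in `x`, so it is made by explicit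
pivoted elimination (`factor_spec`, `aemeasurable_factor`). The bound `‖r j(x)‖² ≤ ‖A(x)‖` then
makes these fibers those of a Bessel family. -/

noncomputable section

namespace ObliqueDuals

/-! ### Synthesis operators, frame operators and their pseudo-inverses in a Hilbert space. -/

section HilbertFrames

open ContinuousLinearMap

variable {H : Type*} [NormedAddCommGroup H] [InnerProductSpace ℂ H]
variable {ι : Type}

/-- The coordinate vectors of `ℓ²(ι)`. -/
def unitVec (i : ι) : ell2 ι := by
  classical exact lp.single 2 i (1 : ℂ)

theorem hasSum_smul_unitVec (a : ell2 ι) : HasSum (fun i => a i • unitVec i) a := by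
  classical
  have h := lp.hasSum_single (E := fun _ : ι => ℂ) (p := 2) (by simp) a
  refine h.congr_fun fun i => ?_
  rw [unitVec, ← lp.single_smul]
  simp

theorem inner_unitVec_left (i : ι) (a : ell2 ι) : inner ℂ (unitVec i) a = a i := by
  classical
  rw [unitVec, lp.inner_single_left]
  simp

theorem clm_ext_unitVec {S T : ell2 ι →L[ℂ] H} (h : ∀ i, S (unitVec i) = T (unitVec i)) :
    S = T := by
  ext a
  have h1 := (hasSum_smul_unitVec a).mapL S
  have h2 := (hasSum_smul_unitVec a).mapL T
  simp only [map_smul, h] at h1 h2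
  exact h1.unique h2

theorem hasSum_of_apply_unitVec {f : ι → H} {T : ell2 ι →L[ℂ] H}
    (hT : ∀ i, T (unitVec i) = f i) (a : ell2 ι) : HasSum (fun i => a i • f i) (T a) := by
  simpa only [map_smul, hT] using (hasSum_smul_unitVec a).mapL T

variable [CompleteSpace H]

theorem adjoint_apply_coord {f : ι → H} {T : ell2 ι →L[ℂ] H}
    (hT : ∀ i, T (unitVec i) = f i) (h : H) (i : ι) :
    adjoint T h i = inner ℂ (f i) h := by
  rw [← inner_unitVec_left, adjoint_inner_right, hT]

theorem hasSum_norm_sq_coord (a : ell2 ι) : HasSum (fun i => ‖a i‖ ^ 2) (‖a‖ ^ 2) := by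
  have h := lp.hasSum_norm (p := 2) (by norm_num) a
  simpa using h

theorem isBessel_of_apply_unitVec {f : ι → H} {T : ell2 ι →L[ℂ] H}
    (hT : ∀ i, T (unitVec i) = f i) : IsBessel f := by
  refine ⟨‖adjoint T‖ ^ 2 + 1, by positivity, fun h => ?_⟩
  have hs := hasSum_norm_sq_coord (adjoint T h)
  simp only [adjoint_apply_coord hT] at hs
  refine ⟨hs.summable, ?_⟩
  rw [hs.tsum_eq]
  have := (adjoint T).le_opNorm h
  calc ‖adjoint T h‖ ^ 2 ≤ (‖adjoint T‖ * ‖h‖) ^ 2 := by gcongr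
    _ ≤ _ := by nlinarith [sq_nonneg ‖h‖]

/-- The Bessel bound says that the analysis map is bounded into `ℓ²`, with norm at most `√b`;
synthesis is its adjoint. -/
theorem IsBessel.exists_synthesis {f : ι → H} (hf : IsBessel f) :
    ∃ T : ell2 ι →L[ℂ] H, ∀ i, T (unitVec i) = f i := by
  obtain ⟨b, hb, h⟩ := hf
  have hmem : ∀ x : H, Memℓp (fun i => inner ℂ (f i) x) 2 := fun x => by
    refine memℓp_gen ?_
    simpa using (h x).1
  let A : H →ₗ[ℂ] ell2 ι :=
    { toFun := fun x => ⟨fun i => inner ℂ (f i) x, hmem x⟩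
      map_add' := fun x y => Subtype.ext (funext fun i => inner_add_right _ _ _)
      map_smul' := fun c x => Subtype.ext (funext fun i => inner_smul_right _ _ _) }
  have hA : ∀ x i, A x i = inner ℂ (f i) x := fun x i => rfl
  let A' : H →L[ℂ] ell2 ι := A.mkContinuous (Real.sqrt b) fun x => by
    have hs := hasSum_norm_sq_coord (A x)
    simp only [hA] at hs
    have h2 : ‖A x‖ ^ 2 ≤ b * ‖x‖ ^ 2 := by rw [← hs.tsum_eq]; exact (h x).2
    rw [← Real.sqrt_sq (norm_nonneg x), ← Real.sqrt_mul hb.le]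
    exact Real.le_sqrt_of_sq_le h2
  refine ⟨adjoint A', fun i => ext_inner_right ℂ fun x => ?_⟩
  rw [adjoint_inner_left, inner_unitVec_left]
  rfl

theorem IsBessel.synthesis_unitVec {f : ι → H} (hf : IsBessel f) (i : ι) :
    synthesis f (unitVec i) = f i := by
  classical
  obtain ⟨T, hT⟩ := hf.exists_synthesis
  have h : ∃ T : ell2 ι →L[ℂ] H, ∀ a : ell2 ι, HasSum (fun i => a i • f i) (T a) :=
    ⟨T, hasSum_of_apply_unitVec hT⟩
  rw [synthesis, dif_pos h]
  refine (h.choose_spec (unitVec i)).unique ?_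
  have := hasSum_of_apply_unitVec hT (unitVec i)
  rwa [hT] at this

theorem synthesis_eq {f : ι → H} {T : ell2 ι →L[ℂ] H} (hT : ∀ i, T (unitVec i) = f i) :
    synthesis f = T :=
  clm_ext_unitVec fun i => by
    rw [(isBessel_of_apply_unitVec hT).synthesis_unitVec, hT]

theorem IsBessel.hasSum_synthesis {f : ι → H} (hf : IsBessel f) (a : ell2 ι) :
    HasSum (fun i => a i • f i) (synthesis f a) :=
  hasSum_of_apply_unitVec hf.synthesis_unitVec a

theorem IsBessel.adjoint_synthesis_apply {f : ι → H} (hf : IsBessel f) (h : H) (i : ι) :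
    adjoint (synthesis f) h i = inner ℂ (f i) h :=
  adjoint_apply_coord hf.synthesis_unitVec h i

theorem IsBessel.map {f : ι → H} (hf : IsBessel f) (L : H →L[ℂ] H) :
    IsBessel fun i => L (f i) :=
  isBessel_of_apply_unitVec (T := L ∘L synthesis f) fun i => by
    rw [comp_apply, hf.synthesis_unitVec]

theorem IsBessel.synthesis_map {f : ι → H} (hf : IsBessel f) (L : H →L[ℂ] H) :
    synthesis (fun i => L (f i)) = L ∘L synthesis f :=
  synthesis_eq fun i => by rw [comp_apply, hf.synthesis_unitVec]

theorem IsBessel.sub {f g : ι → H} (hf : IsBessel f) (hg : IsBessel g) :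
    IsBessel fun i => f i - g i :=
  isBessel_of_apply_unitVec (T := synthesis f - synthesis g) fun i => by
    rw [sub_apply, hf.synthesis_unitVec, hg.synthesis_unitVec]

theorem IsBessel.synthesis_sub {f g : ι → H} (hf : IsBessel f) (hg : IsBessel g) :
    synthesis (fun i => f i - g i) = synthesis f - synthesis g :=
  synthesis_eq fun i => by rw [sub_apply, hf.synthesis_unitVec, hg.synthesis_unitVec]

theorem isSelfAdjoint_frameOperator (f : ι → H) : IsSelfAdjoint (frameOperator f) := by
  rw [isSelfAdjoint_iff', frameOperator, adjoint_comp, adjoint_adjoint]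

theorem adjoint_orthProj (V : ClosedSubmodule ℂ H) : adjoint (orthProj V) = orthProj V :=
  isSelfAdjoint_iff'.1 (isSelfAdjoint_starProjection _)

theorem orthProj_eq_self_iff {V : ClosedSubmodule ℂ H} {h : H} : orthProj V h = h ↔ h ∈ V :=
  Submodule.starProjection_eq_self_iff

theorem orthProj_mem (V : ClosedSubmodule ℂ H) (h : H) : orthProj V h ∈ V :=
  Submodule.starProjection_apply_mem V.toSubmodule h

theorem orthProj_comp_self (V : ClosedSubmodule ℂ H) : orthProj V ∘L orthProj V = orthProj V := by
  ext h
  exact orthProj_eq_self_iff.2 (orthProj_mem V h)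

/-- The frame bounds are assumed only on `W`, but the coefficients of a vector depend only on its
projection to `W`. -/
theorem IsFrameFor.isBessel {W : ClosedSubmodule ℂ H} {f : ι → H} (hf : IsFrameFor W f) :
    IsBessel f := by
  obtain ⟨hW, a, b, ha, hab, h⟩ := hf
  refine ⟨b, ha.trans_le hab, fun x => ?_⟩
  have key : ∀ i, inner ℂ (f i) x = inner ℂ (f i) (orthProj W x) := fun i => by
    rw [← adjoint_inner_left, adjoint_orthProj, orthProj_eq_self_iff.2 (hW i)]
  obtain ⟨h1, -, h3⟩ := h (orthProj W x) (orthProj_mem W x)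
  simp only [key]
  refine ⟨h1, h3.trans ?_⟩
  have : ‖orthProj W x‖ ≤ ‖x‖ := Submodule.norm_starProjection_apply_le _ x
  have hb := ha.le.trans hab
  gcongr

theorem orthProj_comp_synthesis {W : ClosedSubmodule ℂ H} {f : ι → H} (hf : IsBessel f)
    (hW : ∀ i, f i ∈ W) : orthProj W ∘L synthesis f = synthesis f :=
  clm_ext_unitVec fun i => by
    rw [comp_apply, hf.synthesis_unitVec, orthProj_eq_self_iff.2 (hW i)]

theorem orthProj_comp_frameOperator {W : ClosedSubmodule ℂ H} {f : ι → H} (hf : IsBessel f)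
    (hW : ∀ i, f i ∈ W) : orthProj W ∘L frameOperator f = frameOperator f := by
  rw [frameOperator, ← comp_assoc, orthProj_comp_synthesis hf hW]

theorem frameOperator_comp_orthProj {W : ClosedSubmodule ℂ H} {f : ι → H} (hf : IsBessel f)
    (hW : ∀ i, f i ∈ W) : frameOperator f ∘L orthProj W = frameOperator f := by
  have := congrArg adjoint (orthProj_comp_frameOperator hf hW)
  rwa [adjoint_comp, adjoint_orthProj, isSelfAdjoint_iff'.1 (isSelfAdjoint_frameOperator f)] at this

/-- Filling in the identity on `Wᗮ` makes `S + (1 - P)` invertible on the whole space. It commutes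
with `P`, and its inverse composed with `P` inverts `S` on `W`. -/
theorem IsFrameFor.exists_inverse {W : ClosedSubmodule ℂ H} {f : ι → H} (hf : IsFrameFor W f) :
    ∃ B : H →L[ℂ] H, frameOperator f ∘L B = orthProj W ∧ B ∘L frameOperator f = orthProj W ∧
      orthProj W ∘L B = B := by
  have hB := hf.isBessel
  obtain ⟨hW, a, b, ha, hab, h⟩ := hf
  have hPS := orthProj_comp_frameOperator hB hW
  have hSP := frameOperator_comp_orthProj hB hW
  have hPP := orthProj_comp_self W
  set S := frameOperator f with hS
  set P := orthProj W with hP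
  let C : H →L[ℂ] H := S + (1 - P)
  -- The quadratic form of `C` is at least `a` on `W` and equal to `1` on `Wᗮ`, without cross terms;
  -- hence the constant `min a 1`.
  have hC : IsUnit C := by
    refine isUnit_of_forall_le_norm_inner_map C (c := ⟨min a 1, by positivity⟩)
      (by change 0 < min a 1; positivity) fun x => ?_
    change ‖x‖ ^ 2 * min a 1 ≤ _
    have e1 : inner ℂ (S x) x = ((‖adjoint (synthesis f) (P x)‖ ^ 2 : ℝ) : ℂ) := by
      have : inner ℂ (S x) x = inner ℂ (S (P x)) (P x) := by
        rw [← adjoint_inner_left, adjoint_orthProj, ← hP, ← comp_apply, ← comp_apply, hPS, hSP]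
      rw [this, hS, frameOperator, comp_apply, ← adjoint_inner_right, inner_self_eq_norm_sq_to_K]
      norm_cast
    have e2 : inner ℂ ((1 - P) x) x = ((‖(1 - P) x‖ ^ 2 : ℝ) : ℂ) := by
      have h0 : inner ℂ ((1 - P) x) (P x) = 0 := by
        rw [← adjoint_inner_left, adjoint_orthProj, ← comp_apply, comp_sub, ← hP, hPP]
        simp
      have hx : x = (1 - P) x + P x := by simp
      calc inner ℂ ((1 - P) x) x = inner ℂ ((1 - P) x) ((1 - P) x + P x) := by rw [← hx]
        _ = _ := by
          rw [inner_add_right, h0, add_zero, inner_self_eq_norm_sq_to_K]; norm_cast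
    have e3 : inner ℂ (C x) x =
        ((‖adjoint (synthesis f) (P x)‖ ^ 2 + ‖(1 - P) x‖ ^ 2 : ℝ) : ℂ) := by
      rw [show C x = S x + (1 - P) x from rfl, inner_add_left, e1, e2]; norm_cast
    rw [e3, Complex.norm_real, Real.norm_of_nonneg (by positivity)]
    have e4 : a * ‖P x‖ ^ 2 ≤ ‖adjoint (synthesis f) (P x)‖ ^ 2 := by
      have hs := hasSum_norm_sq_coord (adjoint (synthesis f) (P x))
      simp only [hB.adjoint_synthesis_apply] at hs
      rw [← hs.tsum_eq]
      exact (h (P x) (orthProj_mem W x)).2.1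
    have e5 : ‖x‖ ^ 2 = ‖P x‖ ^ 2 + ‖(1 - P) x‖ ^ 2 := by
      have h0 : inner ℂ (P x) ((1 - P) x) = 0 := by
        rw [← adjoint_inner_right, adjoint_orthProj, ← comp_apply, comp_sub, ← hP, hPP]
        simp
      have := norm_add_sq_eq_norm_sq_add_norm_sq_of_inner_eq_zero _ _ h0
      have hx : P x + (1 - P) x = x := by simp
      rw [hx] at this
      nlinarith
    have m1 := min_le_left a 1
    have m2 := min_le_right a 1
    rw [e5]
    nlinarith [sq_nonneg ‖P x‖, sq_nonneg ‖(1 - P) x‖]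
  obtain ⟨u, hu⟩ := hC
  have hCP : C * P = S := by
    have : (1 - P) * P = 0 := by rw [sub_mul, one_mul, mul_def, hPP, sub_self]
    change (S + (1 - P)) * P = S
    rw [add_mul, this, add_zero, mul_def, hSP]
  have hPC : P * C = S := by
    have : P * (1 - P) = 0 := by rw [mul_sub, mul_one, mul_def, hPP, sub_self]
    change P * (S + (1 - P)) = S
    rw [mul_add, this, add_zero, mul_def, hPS]
  have hcomm : (↑u⁻¹ : H →L[ℂ] H) * P = P * ↑u⁻¹ := by
    rw [Units.inv_mul_eq_iff_eq_mul, ← mul_assoc, Units.eq_mul_inv_iff_mul_eq, hu, hCP, hPC]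
  refine ⟨↑u⁻¹ * P, ?_, ?_, ?_⟩
  · rw [← mul_def, hcomm, ← mul_assoc, ← hPC, mul_assoc P C P, hCP, ← hPC, mul_assoc, mul_assoc, ← hu,
      Units.mul_inv, mul_one, mul_def, hPP]
  · rw [← mul_def, mul_assoc, mul_def P S, hPS, ← hCP, ← mul_assoc, ← hu, Units.inv_mul, one_mul]
  · rw [← mul_def, hcomm, ← mul_assoc, mul_def P P, hPP]

/-- The pseudo-inverse is a chosen object known only through the Penrose equations. These make `S B`
and `B S` self-adjoint, and each agrees with `P` after multiplication by `P` on one side, which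
identifies it with `P`. -/
theorem IsFrameFor.pseudoInverse_spec {W : ClosedSubmodule ℂ H} {f : ι → H}
    (hf : IsFrameFor W f) :
    frameOperator f ∘L pseudoInverse (frameOperator f) = orthProj W ∧
      pseudoInverse (frameOperator f) ∘L frameOperator f = orthProj W ∧
      orthProj W ∘L pseudoInverse (frameOperator f) = pseudoInverse (frameOperator f) := by
  classical
  obtain ⟨B₀, h1, h2, h3⟩ := hf.exists_inverse
  have hPS := orthProj_comp_frameOperator hf.isBessel hf.1
  have hSP := frameOperator_comp_orthProj hf.isBessel hf.1
  have hsa := isSelfAdjoint_iff'.2 (adjoint_orthProj W)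
  set S := frameOperator f
  set P := orthProj W
  have hex : ∃ B, IsMoorePenrose S B := by
    refine ⟨B₀, ?_, ?_, ?_, ?_⟩
    · rw [h2, hSP]
    · rw [← comp_assoc, h2, h3]
    · rwa [h1]
    · rwa [h2]
  have hB : IsMoorePenrose S (pseudoInverse S) := by
    rw [pseudoInverse, dif_pos hex]; exact hex.choose_spec
  generalize pseudoInverse S = B at hB
  obtain ⟨b1, b2, b3, b4⟩ := hB
  have c1 : S ∘L B = P := by
    have e1 : P ∘L (S ∘L B) = S ∘L B := by rw [← comp_assoc, hPS]
    have e2 : (S ∘L B) ∘L P = S ∘L B := by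
      have := congrArg adjoint e1
      rwa [adjoint_comp, isSelfAdjoint_iff'.1 b3, isSelfAdjoint_iff'.1 hsa] at this
    have e3 : (S ∘L B) ∘L P = P := by rw [← h1, ← comp_assoc, comp_assoc S B S, b1]
    rw [← e2, e3]
  have c2 : B ∘L S = P := by
    have e1 : (B ∘L S) ∘L P = B ∘L S := by rw [comp_assoc, hSP]
    have e2 : P ∘L (B ∘L S) = B ∘L S := by
      have := congrArg adjoint e1
      rwa [adjoint_comp, isSelfAdjoint_iff'.1 b4, isSelfAdjoint_iff'.1 hsa] at this
    have e3 : P ∘L (B ∘L S) = P := by rw [← h2, comp_assoc, b1]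
    rw [← e2, e3]
  exact ⟨c1, c2, by rw [← c2, comp_assoc, b2]⟩

end HilbertFrames

/-! ### The tiling of `ℝᵏ` by lattice translates of the cube. -/

section Tiling

variable {k : ℕ}

theorem latticeVec_apply (l : Fin k → ℤ) (i : Fin k) : latticeVec l i = (l i : ℝ) := rfl

theorem measurableSet_torus (k : ℕ) : MeasurableSet (torus k) := by
  have : torus k = ⋂ i, (fun x : Rk k => x i) ⁻¹' Set.Ico (-(1 / 2) : ℝ) (1 / 2) := by
    ext x; simp [torus]
  rw [this]
  exact MeasurableSet.iInter fun i => (by fun_prop : Measurable fun x : Rk k => x i) measurableSet_Ico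

/-- The lattice point nearest to `y`, with ties resolved upwards. -/
def nearestLattice (y : Rk k) : Fin k → ℤ := fun i => ⌊y i + 1 / 2⌋

theorem measurable_nearestLattice : Measurable (nearestLattice : Rk k → Fin k → ℤ) :=
  measurable_pi_lambda _ fun i => Int.measurable_floor.comp (by fun_prop)

theorem sub_mem_torus_iff {y : Rk k} {l : Fin k → ℤ} :
    y - latticeVec l ∈ torus k ↔ nearestLattice y = l := by
  rw [funext_iff]
  refine forall_congr' fun i => ?_
  rw [nearestLattice, Int.floor_eq_iff, Set.mem_Ico]
  change -(1 / 2) ≤ y i - (l i : ℝ) ∧ y i - (l i : ℝ) < 1 / 2 ↔ _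
  constructor <;> rintro ⟨h1, h2⟩ <;> constructor <;> linarith

theorem nearestLattice_add {x : Rk k} (hx : x ∈ torus k) (l : Fin k → ℤ) :
    nearestLattice (x + latticeVec l) = l :=
  sub_mem_torus_iff.1 (by rwa [add_sub_cancel_right])

theorem lintegral_eq_tsum_torus (f : Rk k → ENNReal) :
    ∫⁻ y, f y = ∑' l : Fin k → ℤ, ∫⁻ x, f (x + latticeVec l) ∂torusMeasure k := by
  let A : (Fin k → ℤ) → Set (Rk k) := fun l => {y | y - latticeVec l ∈ torus k}
  have hA : ∀ l, MeasurableSet (A l) := fun l =>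
    (measurableSet_torus k).preimage (measurable_id.sub_const _)
  have hU : ⋃ l, A l = Set.univ := by
    refine Set.eq_univ_of_forall fun y => Set.mem_iUnion.2 ⟨nearestLattice y, ?_⟩
    exact sub_mem_torus_iff.2 rfl
  have hD : Pairwise (Function.onFun Disjoint A) := fun l m hlm =>
    Set.disjoint_left.2 fun y hl hm =>
      hlm ((sub_mem_torus_iff.1 hl).symm.trans (sub_mem_torus_iff.1 hm))
  rw [← setLIntegral_univ, ← hU, lintegral_iUnion hA hD]
  refine tsum_congr fun l => ?_
  have hmp := measurePreserving_add_right (volume : Measure (Rk k)) (latticeVec l)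
  rw [torusMeasure, hmp.setLIntegral_comp_emb (measurableEmbedding_addRight _)]
  congr 2
  ext y
  simp only [A, Set.mem_ofPred_eq, Set.mem_image]
  exact ⟨fun h => ⟨_, h, sub_add_cancel _ _⟩, by rintro ⟨x, hx, rfl⟩; simpa using hx⟩

theorem ae_torus_add_lattice {p : Rk k → Prop} (hp : ∀ᵐ y, p y) :
    ∀ᵐ x ∂torusMeasure k, ∀ l : Fin k → ℤ, p (x + latticeVec l) := by
  rw [ae_all_iff]
  exact fun l => ae_restrict_of_ae
    ((measurePreserving_add_right (volume : Measure (Rk k)) (latticeVec l)).quasiMeasurePreserving.ae hp)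

theorem ae_mem_torus (k : ℕ) : ∀ᵐ x ∂torusMeasure k, x ∈ torus k :=
  ae_restrict_mem (measurableSet_torus k)

instance isFiniteMeasure_torusMeasure (k : ℕ) : IsFiniteMeasure (torusMeasure k) := by
  refine ⟨?_⟩
  rw [torusMeasure, Measure.restrict_apply_univ]
  refine Bornology.IsBounded.measure_lt_top ?_
  refine (Metric.isBounded_iff_subset_closedBall 0).2 ⟨Real.sqrt (∑ _i : Fin k, 1), fun x hx => ?_⟩
  rw [mem_closedBall_zero_iff, EuclideanSpace.norm_eq]
  refine Real.sqrt_le_sqrt (Finset.sum_le_sum fun i _ => ?_)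
  have := hx i
  have h2 : ‖x i‖ ≤ 1 := by
    rw [Real.norm_eq_abs, abs_le]; constructor <;> linarith [this.1, this.2]
  nlinarith [norm_nonneg (x i)]

end Tiling

/-! ### The Fourier transform turns lattice translations into multiplication by characters. -/

section Modulation

variable {k : ℕ}

/-- The character `x ↦ exp (-2πi l·x)` of the torus. -/
def character (l : Fin k → ℤ) (x : Rk k) : ℂ := (𝐞 (-inner ℝ (latticeVec l) x) : Circle)

theorem norm_character (l : Fin k → ℤ) (x : Rk k) : ‖character l x‖ = 1 := Circle.norm_coe _

theorem continuous_character (l : Fin k → ℤ) : Continuous (character l : Rk k → ℂ) := by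
  unfold character
  have : Continuous fun x : Rk k => 𝐞 (-inner ℝ (latticeVec l) x) :=
    Real.continuous_fourierChar.comp (by fun_prop)
  exact continuous_subtype_val.comp this

theorem inner_latticeVec (l : Fin k → ℤ) (x : Rk k) :
    inner ℝ (latticeVec l) x = ∑ i, (l i : ℝ) * x i := by
  simp [PiLp.inner_apply, latticeVec_apply, mul_comm]

theorem character_add_latticeVec (l m : Fin k → ℤ) (x : Rk k) :
    character l (x + latticeVec m) = character l x := by
  have h : inner ℝ (latticeVec l) (latticeVec m) = ((∑ i, l i * m i : ℤ) : ℝ) := by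
    rw [inner_latticeVec]; simp [latticeVec_apply]
  rw [character, inner_add_right, neg_add, AddChar.map_add_eq_mul, Circle.coe_mul, h]
  have : ((𝐞 (-((∑ i, l i * m i : ℤ) : ℝ)) : Circle) : ℂ) = 1 := by
    rw [Real.fourierChar_apply, Complex.exp_eq_one_iff]
    exact ⟨-∑ i, l i * m i, by push_cast; ring⟩
  rw [this, mul_one, character]

theorem memLp_character_mul (l : Fin k → ℤ) (f : L2 k) :
    MemLp (fun x => character l x * f x) 2 :=
  (Lp.memLp f).of_le ((continuous_character l).aestronglyMeasurable.mul (Lp.aestronglyMeasurable f))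
    (Filter.Eventually.of_forall fun x => by rw [norm_mul, norm_character, one_mul])

/-- Multiplication by a character, as an isometry of `L²(ℝᵏ)`. -/
def modulation (l : Fin k → ℤ) : L2 k →ₗᵢ[ℂ] L2 k where
  toFun f := (memLp_character_mul l f).toLp
  map_add' f g := by
    apply Lp.ext
    filter_upwards [(memLp_character_mul l (f + g)).coeFn_toLp, (memLp_character_mul l f).coeFn_toLp,
      (memLp_character_mul l g).coeFn_toLp, Lp.coeFn_add f g,
      Lp.coeFn_add (memLp_character_mul l f).toLp (memLp_character_mul l g).toLp]
      with x h1 h2 h3 h4 h5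
    rw [h1, h5, Pi.add_apply, h2, h3, h4, Pi.add_apply, mul_add]
  map_smul' c f := by
    apply Lp.ext
    filter_upwards [(memLp_character_mul l (c • f)).coeFn_toLp, (memLp_character_mul l f).coeFn_toLp,
      Lp.coeFn_smul c f, Lp.coeFn_smul c (memLp_character_mul l f).toLp] with x h1 h2 h4 h5
    rw [RingHom.id_apply, h1, h5, Pi.smul_apply, h2, h4, Pi.smul_apply, smul_eq_mul, smul_eq_mul]
    ring
  norm_map' f := by
    change ‖(memLp_character_mul l f).toLp‖ = ‖f‖
    rw [Lp.norm_toLp, Lp.norm_def]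
    congr 1
    exact eLpNorm_congr_norm_ae
      (Filter.Eventually.of_forall fun x => by rw [norm_mul, norm_character, one_mul])

theorem modulation_coeFn (l : Fin k → ℤ) (f : L2 k) :
    modulation l f =ᵐ[volume] fun x => character l x * f x :=
  (memLp_character_mul l f).coeFn_toLp

/-- Translation by a lattice vector, as an isometry of `L²(ℝᵏ)`. -/
def translateL (l : Fin k → ℤ) : L2 k →ₗᵢ[ℂ] L2 k :=
  Lp.compMeasurePreservingₗᵢ ℂ (fun x : Rk k => x - latticeVec l)
    (measurePreserving_sub_right volume (latticeVec l))

theorem translateL_apply (l : Fin k → ℤ) (f : L2 k) : translateL l f = translate l f := rfl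

theorem translate_coeFn (l : Fin k → ℤ) (f : L2 k) :
    translate l f =ᵐ[volume] fun x => f (x - latticeVec l) :=
  Lp.coeFn_compMeasurePreserving f (measurePreserving_sub_right volume (latticeVec l))

theorem fourier_translate_schwartz (l : Fin k → ℤ) (f : SchwartzMap (Rk k) ℂ) :
    (𝓕 (translate l (f.toLp 2)) : L2 k) = modulation l (𝓕 (f.toLp 2) : L2 k) := by
  have h1 : translate l (f.toLp 2) = (f.compSubConstCLM ℂ (latticeVec l)).toLp 2 := by
    apply Lp.ext
    filter_upwards [translate_coeFn l (f.toLp 2),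
      (f.compSubConstCLM ℂ (latticeVec l)).coeFn_toLp 2 volume,
      (measurePreserving_sub_right (volume : Measure (Rk k))
        (latticeVec l)).quasiMeasurePreserving.ae (f.coeFn_toLp 2 volume)] with x h1 h2 h3
    rw [h1, h2, h3, SchwartzMap.compSubConstCLM_apply]
  rw [h1, SchwartzMap.toLp_fourier_eq, SchwartzMap.toLp_fourier_eq]
  apply Lp.ext
  filter_upwards [(𝓕 (f.compSubConstCLM ℂ (latticeVec l))).coeFn_toLp 2 volume,
    (𝓕 f).coeFn_toLp 2 volume, modulation_coeFn l ((𝓕 f).toLp 2)] with w h1 h2 h3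
  rw [h1, h3, h2, SchwartzMap.fourier_coe, SchwartzMap.fourier_coe, Real.fourier_eq, Real.fourier_eq]
  rw [← integral_add_right_eq_self _ (latticeVec l), ← integral_const_mul]
  congr 1
  ext v
  rw [SchwartzMap.compSubConstCLM_apply, add_sub_cancel_right, inner_add_left, neg_add,
    AddChar.map_add_eq_mul, Circle.smul_def, Circle.smul_def, Circle.coe_mul, character]
  simp only [smul_eq_mul]
  ring

/-- Both sides are continuous in `f`, so the Schwartz case, where the Fourier integral is available,
suffices by density. -/
theorem fourier_translate (l : Fin k → ℤ) (f : L2 k) :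
    (𝓕 (translate l f) : L2 k) = modulation l (𝓕 f : L2 k) := by
  refine DenseRange.induction_on
    (p := fun f : L2 k => (𝓕 (translate l f) : L2 k) = modulation l (𝓕 f : L2 k))
    (SchwartzMap.denseRange_toLpCLM (p := 2) (μ := (volume : Measure (Rk k)))
      ENNReal.ofNat_ne_top) f ?_ (fourier_translate_schwartz l)
  exact isClosed_eq
    ((Lp.fourierTransformₗᵢ (Rk k) ℂ).continuous.comp (translateL l).continuous)
    ((modulation l).continuous.comp (Lp.fourierTransformₗᵢ (Rk k) ℂ).continuous)

end Modulation

/-! ### Fiberization as an isometry onto the square-integrable fields over the cube. -/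

section Fibers

variable {k : ℕ} {ι : Type}

theorem tsum_enorm_sq_coord (a : ell2 ι) : ∑' i, ‖a i‖ₑ ^ 2 = ‖a‖ₑ ^ 2 := by
  have h := hasSum_norm_sq_coord a
  have e : ∀ z : ℂ, ‖z‖ₑ ^ 2 = ENNReal.ofReal (‖z‖ ^ 2) := fun z => by
    rw [← ofReal_norm, ENNReal.ofReal_pow (norm_nonneg _)]
  simp only [e]
  rw [← ofReal_norm, ← ENNReal.ofReal_pow (norm_nonneg _), ← h.tsum_eq,
    ENNReal.ofReal_tsum_of_nonneg (fun i => by positivity) h.summable]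

theorem memℓp_two_of_tsum_lt_top {a : ι → ℂ} (h : ∑' i, ‖a i‖ₑ ^ 2 ≠ ⊤) : Memℓp a 2 := by
  refine memℓp_gen ?_
  have := ENNReal.summable_toReal h
  simpa using this

theorem aestronglyMeasurable_ell2 {X : Type*} [MeasurableSpace X] {μ : Measure X} [Countable ι]
    {g : X → ell2 ι} (hg : ∀ i, AEStronglyMeasurable (fun x => g x i) μ) :
    AEStronglyMeasurable g μ := by
  refine aestronglyMeasurable_of_tendsto_ae (u := Filter.atTop)
    (f := fun (s : Finset ι) x => ∑ i ∈ s, g x i • unitVec i) (fun s => ?_)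
    (Filter.Eventually.of_forall fun x => hasSum_smul_unitVec (g x))
  exact Finset.aestronglyMeasurable_fun_sum _ fun i _ => (hg i).smul_const _

instance separableSpace_ell2 [Countable ι] : TopologicalSpace.SeparableSpace (ell2 ι) := by
  rw [← TopologicalSpace.isSeparable_univ_iff]
  have h : TopologicalSpace.IsSeparable
      (closure (Submodule.span ℂ (Set.range (unitVec : ι → ell2 ι)) : Set (ell2 ι))) :=
    ((Set.countable_range _).isSeparable.span (R := ℂ)).closure
  refine h.mono fun a _ => ?_
  refine mem_closure_of_tendsto (hasSum_smul_unitVec a) (Filter.Eventually.of_forall fun s => ?_)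
  exact Submodule.sum_mem _ fun i _ =>
    Submodule.smul_mem _ _ (Submodule.subset_span (Set.mem_range_self i))

theorem lintegral_enorm_sq_ne_top (f : L2 k) : ∫⁻ y, ‖f y‖ₑ ^ 2 ≠ ⊤ := by
  have := (eLpNorm_lt_top_iff_lintegral_rpow_enorm_lt_top (by norm_num) (by norm_num)).1
    (Lp.memLp f).2
  simpa using this.ne

theorem aemeasurable_comp_add_lattice {f : Rk k → ℂ} (hf : AEStronglyMeasurable f volume)
    (l : Fin k → ℤ) :
    AEStronglyMeasurable (fun x => f (x + latticeVec l)) (torusMeasure k) :=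
  (hf.comp_quasiMeasurePreserving (measurePreserving_add_right (volume : Measure (Rk k))
    (latticeVec l)).quasiMeasurePreserving).mono_measure Measure.restrict_le_self

theorem lintegral_tsum_fiber (f : Rk k → ℂ) (hf : AEStronglyMeasurable f volume) :
    ∫⁻ x, ∑' l : Fin k → ℤ, ‖f (x + latticeVec l)‖ₑ ^ 2 ∂torusMeasure k = ∫⁻ y, ‖f y‖ₑ ^ 2 := by
  rw [lintegral_eq_tsum_torus, lintegral_tsum]
  exact fun l => ((aemeasurable_comp_add_lattice hf l).enorm).pow_const 2

theorem ae_fiber_apply (f : L2 k) :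
    ∀ᵐ x ∂torusMeasure k, ∀ l, fiber f x l = (𝓕 f : L2 k) (x + latticeVec l) := by
  have hm := Lp.aestronglyMeasurable (𝓕 f : L2 k)
  have h := ae_lt_top' (AEMeasurable.tsum
    fun l => ((aemeasurable_comp_add_lattice hm l).enorm).pow_const 2)
    ((lintegral_tsum_fiber _ hm).trans_ne (lintegral_enorm_sq_ne_top _))
  filter_upwards [h] with x hx l
  rw [fiber, dif_pos (memℓp_two_of_tsum_lt_top hx.ne)]

theorem aestronglyMeasurable_fiber (f : L2 k) :
    AEStronglyMeasurable (fiber f) (torusMeasure k) :=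
  aestronglyMeasurable_ell2 fun l =>
    (aemeasurable_comp_add_lattice (Lp.aestronglyMeasurable (𝓕 f : L2 k)) l).congr <| by
      filter_upwards [ae_fiber_apply f] with x hx using (hx l).symm

theorem eLpNorm_fiber (f : L2 k) :
    eLpNorm (fiber f) 2 (torusMeasure k) = eLpNorm (𝓕 f : L2 k) 2 volume := by
  rw [eLpNorm_eq_lintegral_rpow_enorm_toReal (by norm_num) (by norm_num),
    eLpNorm_eq_lintegral_rpow_enorm_toReal (by norm_num) (by norm_num)]
  congr 1
  simp only [ENNReal.toReal_ofNat, ENNReal.rpow_ofNat]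
  rw [← lintegral_tsum_fiber _ (Lp.aestronglyMeasurable (𝓕 f : L2 k))]
  refine lintegral_congr_ae ?_
  filter_upwards [ae_fiber_apply f] with x hx
  simp only [← tsum_enorm_sq_coord, hx]

theorem memLp_fiber (f : L2 k) : MemLp (fiber f) 2 (torusMeasure k) :=
  ⟨aestronglyMeasurable_fiber f, by rw [eLpNorm_fiber]; exact Lp.eLpNorm_lt_top _⟩

theorem fiber_add (f g : L2 k) :
    ∀ᵐ x ∂torusMeasure k, fiber (f + g) x = fiber f x + fiber g x := by
  have h : (𝓕 (f + g) : L2 k) = 𝓕 f + 𝓕 g := (Lp.fourierTransformₗᵢ (Rk k) ℂ).map_add f g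
  filter_upwards [ae_fiber_apply (f + g), ae_fiber_apply f, ae_fiber_apply g,
    ae_torus_add_lattice (Lp.coeFn_add (𝓕 f : L2 k) (𝓕 g))] with x h1 h2 h3 h4
  ext l
  rw [h1, h, h4, lp.coeFn_add, Pi.add_apply, Pi.add_apply, h2, h3]

theorem fiber_smul (c : ℂ) (f : L2 k) :
    ∀ᵐ x ∂torusMeasure k, fiber (c • f) x = c • fiber f x := by
  have h : (𝓕 (c • f) : L2 k) = c • 𝓕 f := (Lp.fourierTransformₗᵢ (Rk k) ℂ).map_smul c f
  filter_upwards [ae_fiber_apply (c • f), ae_fiber_apply f,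
    ae_torus_add_lattice (Lp.coeFn_smul c (𝓕 f : L2 k))] with x h1 h2 h4
  ext l
  rw [h1, h, h4, lp.coeFn_smul, Pi.smul_apply, Pi.smul_apply, h2]

theorem fiber_translate (l : Fin k → ℤ) (f : L2 k) :
    ∀ᵐ x ∂torusMeasure k, fiber (translate l f) x = character l x • fiber f x := by
  filter_upwards [ae_fiber_apply (translate l f), ae_fiber_apply f,
    ae_torus_add_lattice (modulation_coeFn l (𝓕 f : L2 k))] with x h1 h2 h4
  ext m
  rw [h1, fourier_translate, h4, lp.coeFn_smul, Pi.smul_apply, h2, character_add_latticeVec,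
    smul_eq_mul]

/-- The fiberization `f ↦ Γ f`, as an isometry into `L²` of the torus with values in `ℓ²(ℤᵏ)`. -/
def fiberL (k : ℕ) : L2 k →ₗᵢ[ℂ] Lp (FiberSpace k) 2 (torusMeasure k) where
  toFun f := (memLp_fiber f).toLp
  map_add' f g := by
    apply Lp.ext
    filter_upwards [(memLp_fiber (f + g)).coeFn_toLp, (memLp_fiber f).coeFn_toLp,
      (memLp_fiber g).coeFn_toLp, fiber_add f g,
      Lp.coeFn_add (memLp_fiber f).toLp (memLp_fiber g).toLp] with x h1 h2 h3 h4 h5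
    rw [h1, h5, Pi.add_apply, h2, h3, h4]
  map_smul' c f := by
    apply Lp.ext
    filter_upwards [(memLp_fiber (c • f)).coeFn_toLp, (memLp_fiber f).coeFn_toLp,
      fiber_smul c f, Lp.coeFn_smul c (memLp_fiber f).toLp] with x h1 h2 h4 h5
    rw [RingHom.id_apply, h1, h5, Pi.smul_apply, h2, h4]
  norm_map' f := by
    change ‖(memLp_fiber f).toLp‖ = ‖f‖
    rw [Lp.norm_toLp, eLpNorm_fiber, ← Lp.norm_def, Lp.norm_fourier_eq]

theorem fiberL_coeFn (f : L2 k) : fiberL k f =ᵐ[torusMeasure k] fiber f :=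
  (memLp_fiber f).coeFn_toLp

theorem inner_eq_integral_fiber (f g : L2 k) :
    inner ℂ f g = ∫ x, inner ℂ (fiber f x) (fiber g x) ∂torusMeasure k := by
  rw [← (fiberL k).inner_map_map, L2.inner_def]
  refine integral_congr_ae ?_
  filter_upwards [fiberL_coeFn f, fiberL_coeFn g] with x h1 h2
  rw [h1, h2]

theorem eq_of_fiber_ae_eq {f g : L2 k} (h : fiber f =ᵐ[torusMeasure k] fiber g) : f = g :=
  (fiberL k).injective (Lp.ext ((fiberL_coeFn f).trans (h.trans (fiberL_coeFn g).symm)))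

theorem norm_sq_eq_integral_fiber (f : L2 k) :
    ‖f‖ ^ 2 = ∫ x, ‖fiber f x‖ ^ 2 ∂torusMeasure k := by
  have h := inner_eq_integral_fiber f f
  simp only [inner_self_eq_norm_sq_to_K] at h
  have : (∫ x, ((‖fiber f x‖ : ℂ)) ^ 2 ∂torusMeasure k) =
      ((∫ x, ‖fiber f x‖ ^ 2 ∂torusMeasure k : ℝ) : ℂ) := by
    rw [← integral_complex_ofReal]; simp
  apply Complex.ofReal_injective
  rw [Complex.ofReal_pow, ← this]
  exact h

/-- Surjectivity of fiberization. It is the source of every function built fiberwise: test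
functions, images under fiber fields, and the final generators. -/
theorem exists_fiber_eq {Φ : Rk k → FiberSpace k} (hΦ : MemLp Φ 2 (torusMeasure k)) :
    ∃ f : L2 k, fiber f =ᵐ[torusMeasure k] Φ := by
  let Ψ := hΦ.1.mk Φ
  have hΨ : StronglyMeasurable Ψ := hΦ.1.stronglyMeasurable_mk
  have hΨΦ : Φ =ᵐ[torusMeasure k] Ψ := hΦ.1.ae_eq_mk
  have hcoord : ∀ l, Measurable fun x => Ψ x l := fun l => by
    have : StronglyMeasurable fun x => innerSL ℂ (unitVec l) (Ψ x) :=
      (innerSL ℂ (unitVec l)).continuous.comp_stronglyMeasurable hΨ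
    simpa only [innerSL_apply_apply, inner_unitVec_left] using this.measurable
  -- The Fourier transform of the wanted function, glued from the coordinates of `Ψ` over the
  -- translated cubes.
  let g : Rk k → ℂ := fun y => Ψ (y - latticeVec (nearestLattice y)) (nearestLattice y)
  have hlat : Measurable (latticeVec : (Fin k → ℤ) → Rk k) := Measurable.of_discrete
  have hg : Measurable g := by
    have h1 : Measurable fun p : Rk k × (Fin k → ℤ) => Ψ p.1 p.2 :=
      measurable_from_prod_countable_left fun l => hcoord l
    exact h1.comp ((measurable_id.sub (hlat.comp measurable_nearestLattice)).prodMk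
      measurable_nearestLattice)
  have hgx : ∀ x ∈ torus k, ∀ l, g (x + latticeVec l) = Ψ x l := fun x hx l => by
    simp only [g, nearestLattice_add hx, add_sub_cancel_right]
  have hgL : MemLp g 2 volume := by
    refine ⟨hg.aestronglyMeasurable, ?_⟩
    rw [eLpNorm_lt_top_iff_lintegral_rpow_enorm_lt_top (by norm_num) (by norm_num)]
    simp only [ENNReal.toReal_ofNat, ENNReal.rpow_ofNat]
    rw [← lintegral_tsum_fiber g hg.aestronglyMeasurable]
    have h2 := (eLpNorm_lt_top_iff_lintegral_rpow_enorm_lt_top (by norm_num) (by norm_num)).1 hΦ.2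
    simp only [ENNReal.toReal_ofNat, ENNReal.rpow_ofNat] at h2
    convert h2 using 1
    refine lintegral_congr_ae ?_
    filter_upwards [ae_mem_torus k, hΨΦ] with x hx h3
    simp only [hgx x hx, tsum_enorm_sq_coord, h3]
  refine ⟨(𝓕⁻ (hgL.toLp g) : L2 k), ?_⟩
  have hF : (𝓕 (𝓕⁻ (hgL.toLp g) : L2 k) : L2 k) = hgL.toLp g :=
    (Lp.fourierTransformₗᵢ (Rk k) ℂ).apply_symm_apply _
  filter_upwards [ae_fiber_apply (𝓕⁻ (hgL.toLp g) : L2 k), ae_mem_torus k, hΨΦ,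
    ae_torus_add_lattice hgL.coeFn_toLp] with x h1 h2 h3 h4
  ext l
  rw [h1, hF, h4, hgx x h2, h3]

end Fibers

/-! ### Fourier series on the cube, transported from the additive torus. -/

section Parseval

attribute [local instance] instMeasureSpaceUnitAddCircle

variable {k : ℕ}

/-- The representative in `(-1/2, 1/2]ᵏ` of a point of `ℝᵏ / ℤᵏ`. -/
def torusLift (t : UnitAddTorus (Fin k)) : Rk k :=
  WithLp.toLp 2 (UnitAddTorus.measurableEquivPiIoc (fun _ => (-(1 / 2) : ℝ)) t).1

/-- The cube here is closed on the left, while the fundamental domain of the additive torus is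
closed on the right; they differ by a null set. -/
theorem torusMeasure_eq_restrict (k : ℕ) :
    torusMeasure k = volume.restrict
      {x : Rk k | ∀ i, x i ∈ Set.Ioc (-(1 / 2) : ℝ) (-(1 / 2) + 1)} := by
  refine Measure.restrict_congr_set ?_
  have h1 := (Measure.univ_pi_Ico_ae_eq_Icc (μ := fun _ : Fin k => (volume : Measure ℝ))
    (f := fun _ => (-(1 / 2) : ℝ)) (g := fun _ => (1 / 2 : ℝ))).trans
    (Measure.univ_pi_Ioc_ae_eq_Icc (μ := fun _ : Fin k => (volume : Measure ℝ))
    (f := fun _ => (-(1 / 2) : ℝ)) (g := fun _ => (1 / 2 : ℝ))).symm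
  have h2 := (PiLp.volume_preserving_ofLp (Fin k)).quasiMeasurePreserving.preimage_ae_eq h1
  have e1 : torus k = WithLp.ofLp ⁻¹' Set.univ.pi fun _ => Set.Ico (-(1 / 2) : ℝ) (1 / 2) := by
    ext x; simp [torus]
  have e2 : {x : Rk k | ∀ i, x i ∈ Set.Ioc (-(1 / 2) : ℝ) (-(1 / 2) + 1)} =
      WithLp.ofLp ⁻¹' Set.univ.pi fun _ => Set.Ioc (-(1 / 2) : ℝ) (1 / 2) := by
    ext x; norm_num
  rw [e1, e2]
  exact h2

theorem measurePreserving_torusLift :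
    MeasurePreserving (torusLift : UnitAddTorus (Fin k) → Rk k) volume (torusMeasure k) := by
  have hm : MeasurableSet {x : Fin k → ℝ | ∀ i, x i ∈ Set.Ioc (-(1 / 2) : ℝ) (-(1 / 2) + 1)} :=
    MeasurableSet.univ_pi' fun i => measurableSet_Ioc
  have h1 := UnitAddTorus.measurePreserving_equivPiIoc (fun _ : Fin k => (-(1 / 2) : ℝ))
  have h2 := measurePreserving_subtype_coe (μa := (volume : Measure (Fin k → ℝ))) hm
  have h3 := (PiLp.volume_preserving_toLp (Fin k)).restrict_preimage_emb
    (MeasurableEquiv.toLp 2 (Fin k → ℝ)).measurableEmbedding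
    {x : Rk k | ∀ i, x i ∈ Set.Ioc (-(1 / 2) : ℝ) (-(1 / 2) + 1)}
  rw [torusMeasure_eq_restrict]
  exact h3.comp (h2.comp h1)

theorem mFourier_neg_eq_character (n : Fin k → ℤ) (t : UnitAddTorus (Fin k)) :
    UnitAddTorus.mFourier (-n) t = character n (torusLift t) := by
  have ht : t = fun i => ((torusLift t i : ℝ) : UnitAddCircle) := by
    conv_lhs => rw [← (UnitAddTorus.measurableEquivPiIoc
      (fun _ : Fin k => (-(1 / 2) : ℝ))).symm_apply_apply t]
    rfl
  conv_lhs => rw [ht]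
  rw [UnitAddTorus.mFourier, ContinuousMap.coe_mk, character, inner_latticeVec,
    Real.fourierChar_apply]
  simp only [fourier_coe_apply]
  rw [← Complex.exp_sum]
  congr 1
  push_cast
  rw [← Finset.sum_neg_distrib, Finset.mul_sum, Finset.sum_mul]
  refine Finset.sum_congr rfl fun i _ => ?_
  simp
  ring

/-- Parseval's identity for the characters of the torus. -/
theorem hasSum_character_coeff {u v : Rk k → ℂ} (hu : MemLp u 2 (torusMeasure k))
    (hv : MemLp v 2 (torusMeasure k)) :
    HasSum (fun l : Fin k → ℤ => starRingEnd ℂ (∫ x, character l x * u x ∂torusMeasure k) *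
      ∫ x, character l x * v x ∂torusMeasure k)
      (∫ x, starRingEnd ℂ (u x) * v x ∂torusMeasure k) := by
  have hι := measurePreserving_torusLift (k := k)
  have htrans : ∀ w : Rk k → ℂ, AEStronglyMeasurable w (torusMeasure k) →
      ∫ t, w (torusLift t) = ∫ x, w x ∂torusMeasure k := fun w hw => by
    rw [← hι.map_eq] at hw ⊢
    exact (integral_map hι.measurable.aemeasurable hw).symm
  have hcoef : ∀ (w : Rk k → ℂ) (hw : MemLp w 2 (torusMeasure k)) (l : Fin k → ℤ),
      UnitAddTorus.mFourierCoeff ((hw.comp_measurePreserving hι).toLp) l =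
        ∫ x, character l x * w x ∂torusMeasure k := fun w hw l => by
    rw [← htrans (fun x => character l x * w x)
      ((continuous_character l).aestronglyMeasurable.mul hw.1)]
    refine integral_congr_ae ?_
    filter_upwards [(hw.comp_measurePreserving hι).coeFn_toLp] with t ht
    rw [ht, mFourier_neg_eq_character, smul_eq_mul, Function.comp_apply]
  have h := UnitAddTorus.hasSum_prod_mFourierCoeff
    ((hu.comp_measurePreserving hι).toLp) ((hv.comp_measurePreserving hι).toLp)
  simp only [hcoef u hu, hcoef v hv] at h
  convert h using 1
  rw [← htrans (fun x => starRingEnd ℂ (u x) * v x)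
    ((Complex.continuous_conj.comp_aestronglyMeasurable hu.1).mul hv.1)]
  refine integral_congr_ae ?_
  filter_upwards [(hu.comp_measurePreserving hι).coeFn_toLp,
    (hv.comp_measurePreserving hι).coeFn_toLp] with t h1 h2
  rw [h1, h2, Function.comp_apply, Function.comp_apply]

end Parseval

/-! ### A family of translates is Bessel exactly when the fibers of its generators are essentially
bounded. -/

section BoundedFibers

variable {k : ℕ}

theorem conj_character (l : Fin k → ℤ) (x : Rk k) :
    starRingEnd ℂ (character l x) = character (-l) x := by
  have : latticeVec (-l) = -latticeVec l := by ext i; simp [latticeVec]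
  rw [character, character, ← Circle.coe_inv_eq_conj, ← AddChar.map_neg_eq_inv, this,
    inner_neg_left]

theorem inner_translate (g f : L2 k) (l : Fin k → ℤ) :
    inner ℂ (translate l g) f =
      ∫ x, character (-l) x * inner ℂ (fiber g x) (fiber f x) ∂torusMeasure k := by
  rw [inner_eq_integral_fiber]
  refine integral_congr_ae ?_
  filter_upwards [fiber_translate l g] with x hx
  rw [hx, inner_smul_left, conj_character]

/-- Parseval's identity for the inner products with the translates of `g` and `h`. -/
theorem hasSum_inner_translate {g h f f' : L2 k}
    (hg : MemLp (fun x => inner ℂ (fiber g x) (fiber f x) : Rk k → ℂ) 2 (torusMeasure k))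
    (hh : MemLp (fun x => inner ℂ (fiber h x) (fiber f' x) : Rk k → ℂ) 2 (torusMeasure k)) :
    HasSum (fun l : Fin k → ℤ =>
      starRingEnd ℂ (inner ℂ (translate l h) f') * inner ℂ (translate l g) f)
      (∫ x, inner ℂ (fiber f' x) (fiber h x) * inner ℂ (fiber g x) (fiber f x)
        ∂torusMeasure k) := by
  have := (Equiv.neg (Fin k → ℤ)).hasSum_iff.2 (hasSum_character_coeff hh hg)
  simp only [inner_translate]
  convert this using 1
  · rfl
  · simp only [inner_conj_symm]

theorem hasSum_norm_sq_inner_translate {g f : L2 k}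
    (hg : MemLp (fun x => inner ℂ (fiber g x) (fiber f x) : Rk k → ℂ) 2 (torusMeasure k)) :
    HasSum (fun l : Fin k → ℤ => ‖inner ℂ (translate l g) f‖ ^ 2)
      (∫ x, ‖inner ℂ (fiber g x) (fiber f x)‖ ^ 2 ∂torusMeasure k) := by
  have h := hasSum_inner_translate hg hg
  rw [← Complex.hasSum_ofReal]
  convert h using 1
  · ext l; rw [Complex.conj_mul']; push_cast; rfl
  · rw [← integral_complex_ofReal]
    congr 1
    ext x
    rw [← inner_conj_symm (fiber f x), Complex.conj_mul']
    push_cast; rfl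

/-- The fibers of `g` are essentially bounded. -/
def HasBoundedFibers (g : L2 k) : Prop :=
  ∃ C : ℝ, ∀ᵐ x ∂torusMeasure k, ‖fiber g x‖ ≤ C

theorem aestronglyMeasurable_inner_fiber (g f : L2 k) :
    AEStronglyMeasurable (fun x => inner ℂ (fiber g x) (fiber f x)) (torusMeasure k) :=
  (aestronglyMeasurable_fiber g).inner (aestronglyMeasurable_fiber f)

theorem HasBoundedFibers.memLp_inner {g : L2 k} (hg : HasBoundedFibers g) (f : L2 k) :
    MemLp (fun x => inner ℂ (fiber g x) (fiber f x) : Rk k → ℂ) 2 (torusMeasure k) := by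
  obtain ⟨C, hC⟩ := hg
  refine (memLp_fiber f).of_le_mul (c := C) (aestronglyMeasurable_inner_fiber g f) ?_
  filter_upwards [hC] with x hx
  exact (norm_inner_le_norm _ _).trans (by gcongr)

/-- Parseval turns the sum over translates of one generator into the integral of `|⟨G i(x),
f(x)⟩|²`, which is bounded pointwise by Cauchy-Schwarz. -/
theorem isBessel_translates {n : ℕ} {G : Fin n → L2 k} (hG : ∀ i, HasBoundedFibers (G i)) :
    IsBessel (translates G) := by
  choose C hC using hG
  have hb : ∀ (i : Fin n) (f : L2 k),
      ∫ x, ‖inner ℂ (fiber (G i) x) (fiber f x)‖ ^ 2 ∂torusMeasure k ≤ C i ^ 2 * ‖f‖ ^ 2 := by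
    intro i f
    rw [norm_sq_eq_integral_fiber, ← integral_const_mul]
    refine integral_mono_ae ?_ ?_ ?_
    · exact (HasBoundedFibers.memLp_inner ⟨C i, hC i⟩ f).integrable_norm_pow (by norm_num)
    · exact ((memLp_fiber f).integrable_norm_pow (by norm_num)).const_mul _
    · filter_upwards [hC i] with x hx
      rw [← mul_pow]
      have := norm_inner_le_norm (𝕜 := ℂ) (fiber (G i) x) (fiber f x)
      gcongr
      exact this.trans (by gcongr)
  refine ⟨∑ i, C i ^ 2 + 1, by positivity, fun f => ?_⟩
  have hs := fun i => hasSum_norm_sq_inner_translate (HasBoundedFibers.memLp_inner ⟨C i, hC i⟩ f)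
  have hsum : Summable fun p : (Fin k → ℤ) × Fin n => ‖inner ℂ (translates G p) f‖ ^ 2 := by
    rw [← (Equiv.prodComm _ _).summable_iff]
    refine (summable_prod_of_nonneg fun p => sq_nonneg _).2 ⟨fun i => (hs i).summable, ?_⟩
    exact (hasSum_fintype _).summable
  refine ⟨hsum, ?_⟩
  rw [← (Equiv.prodComm (Fin n) (Fin k → ℤ)).tsum_eq]
  have hsum' := (Equiv.prodComm (Fin n) (Fin k → ℤ)).summable_iff.2 hsum
  simp only [Function.comp_def] at hsum'
  rw [hsum'.tsum_prod' fun i => (hs i).summable, tsum_fintype]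
  calc _ ≤ ∑ i, C i ^ 2 * ‖f‖ ^ 2 := Finset.sum_le_sum fun i _ => (hs i).tsum_eq.trans_le (hb i f)
    _ = (∑ i, C i ^ 2) * ‖f‖ ^ 2 := by rw [Finset.sum_mul]
    _ ≤ _ := by gcongr; linarith

/-- The Bessel inequality is tested on the function whose fibers are those of `G i`, cut off to the
set where their squared norm exceeds the Bessel bound `b`; this forces that set to be null. -/
theorem IsBessel.hasBoundedFibers {n : ℕ} {G : Fin n → L2 k} (hG : IsBessel (translates G))
    (i : Fin n) : HasBoundedFibers (G i) := by
  obtain ⟨b, hb, h⟩ := hG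
  suffices hnull : ∀ M : ℕ, ∀ᵐ x ∂torusMeasure k,
      ¬ (b < ‖fiber (G i) x‖ ^ 2 ∧ ‖fiber (G i) x‖ ^ 2 ≤ M) by
    refine ⟨Real.sqrt b, ?_⟩
    filter_upwards [ae_all_iff.2 hnull] with x hx
    obtain ⟨M, hM⟩ := exists_nat_ge (‖fiber (G i) x‖ ^ 2)
    exact Real.le_sqrt_of_sq_le (not_lt.1 fun hlt => hx M ⟨hlt, hM⟩)
  intro M
  obtain ⟨γ, hγ, hγe⟩ := aestronglyMeasurable_fiber (G i)
  -- The upper cut-off `M` keeps the test function and its coefficients square-integrable; the union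
  -- over all `M` recovers the whole exceptional set.
  let A : Set (Rk k) := {x | b < ‖γ x‖ ^ 2 ∧ ‖γ x‖ ^ 2 ≤ M}
  have hA : MeasurableSet A :=
    (measurableSet_lt measurable_const (hγ.norm.measurable.pow_const 2)).inter
      (measurableSet_le (hγ.norm.measurable.pow_const 2) measurable_const)
  have hAγ : MemLp (A.indicator γ) 2 (torusMeasure k) := by
    refine MemLp.of_bound (hγ.indicator hA).aestronglyMeasurable (Real.sqrt M)
      (Filter.Eventually.of_forall fun x => ?_)
    by_cases hx : x ∈ A
    · rw [Set.indicator_of_mem hx]; exact Real.le_sqrt_of_sq_le hx.2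
    · rw [Set.indicator_of_notMem hx, norm_zero]; positivity
  obtain ⟨f, hf⟩ := exists_fiber_eq hAγ
  have hin : (fun x => inner ℂ (fiber (G i) x) (fiber f x) : Rk k → ℂ) =ᵐ[torusMeasure k]
      fun x => A.indicator (fun x => ((‖γ x‖ ^ 2 : ℝ) : ℂ)) x := by
    filter_upwards [hf, hγe] with x h1 h2
    rw [h1, h2]
    by_cases hx : x ∈ A
    · rw [Set.indicator_of_mem hx, Set.indicator_of_mem hx, inner_self_eq_norm_sq_to_K]
      push_cast; rfl
    · rw [Set.indicator_of_notMem hx, Set.indicator_of_notMem hx, inner_zero_right]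
  have hmeas : Measurable fun x => A.indicator (fun x => ‖γ x‖ ^ 2) x :=
    (hγ.norm.measurable.pow_const 2).indicator hA
  have hbd : ∀ x, ‖A.indicator (fun x => ‖γ x‖ ^ 2) x‖ ≤ M := fun x => by
    by_cases hx : x ∈ A
    · rw [Set.indicator_of_mem hx, Real.norm_of_nonneg (by positivity)]; exact hx.2
    · rw [Set.indicator_of_notMem hx, norm_zero]; positivity
  have hL : MemLp (fun x => inner ℂ (fiber (G i) x) (fiber f x) : Rk k → ℂ) 2
      (torusMeasure k) := by
    refine MemLp.of_bound (aestronglyMeasurable_inner_fiber _ _) M ?_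
    filter_upwards [hin] with x hx
    rw [hx]
    by_cases hxA : x ∈ A
    · rw [Set.indicator_of_mem hxA, Complex.norm_real, Real.norm_of_nonneg (by positivity)]
      exact hxA.2
    · rw [Set.indicator_of_notMem hxA, norm_zero]; positivity
  have hs := hasSum_norm_sq_inner_translate hL
  obtain ⟨h1, h2⟩ := h f
  have hle : ∑' l, ‖inner ℂ (translate l (G i)) f‖ ^ 2 ≤ b * ‖f‖ ^ 2 := by
    refine le_trans ?_ h2
    have hinj : Function.Injective fun l : Fin k → ℤ => (l, i) := fun a b hab => by
      simpa using hab
    have := tsum_comp_le_tsum_of_inj h1 (fun p => sq_nonneg _) hinj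
    exact this
  rw [hs.tsum_eq, norm_sq_eq_integral_fiber, ← integral_const_mul] at hle
  have e1 : ∫ x, ‖inner ℂ (fiber (G i) x) (fiber f x)‖ ^ 2 ∂torusMeasure k =
      ∫ x, (A.indicator (fun x => ‖γ x‖ ^ 2) x) ^ 2 ∂torusMeasure k := by
    refine integral_congr_ae ?_
    filter_upwards [hin] with x hx
    rw [hx]
    by_cases hxA : x ∈ A
    · rw [Set.indicator_of_mem hxA, Set.indicator_of_mem hxA, Complex.norm_real,
        Real.norm_of_nonneg (by positivity)]
    · rw [Set.indicator_of_notMem hxA, Set.indicator_of_notMem hxA, norm_zero]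
  have e2 : ∫ x, b * ‖fiber f x‖ ^ 2 ∂torusMeasure k =
      ∫ x, b * A.indicator (fun x => ‖γ x‖ ^ 2) x ∂torusMeasure k := by
    refine integral_congr_ae ?_
    filter_upwards [hf] with x hx
    rw [hx]
    by_cases hxA : x ∈ A
    · rw [Set.indicator_of_mem hxA, Set.indicator_of_mem hxA]
    · rw [Set.indicator_of_notMem hxA, Set.indicator_of_notMem hxA, norm_zero]; simp
  rw [e1, e2] at hle
  have i1 : Integrable (fun x => A.indicator (fun x => ‖γ x‖ ^ 2) x) (torusMeasure k) :=
    Integrable.of_bound hmeas.aestronglyMeasurable M (Filter.Eventually.of_forall hbd)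
  have i2 : Integrable (fun x => (A.indicator (fun x => ‖γ x‖ ^ 2) x) ^ 2) (torusMeasure k) :=
    Integrable.of_bound (hmeas.pow_const 2).aestronglyMeasurable ((M : ℝ) ^ 2)
      (Filter.Eventually.of_forall fun x => by
        rw [norm_pow]; exact pow_le_pow_left₀ (norm_nonneg _) (hbd x) 2)
  set q : Rk k → ℝ := fun x => A.indicator (fun x => ‖γ x‖ ^ 2) x with hq
  -- The Bessel inequality reads `∫ q² ≤ b ∫ q`, while `q (q - b)` is strictly positive on `A` and
  -- zero off it. So the integrand vanishes almost everywhere and `A` is null.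
  have hpos : 0 ≤ fun x => q x ^ 2 - b * q x := fun x => by
    change 0 ≤ q x ^ 2 - b * q x
    by_cases hxA : x ∈ A
    · have h3 : b < q x := by rw [hq]; simpa only [Set.indicator_of_mem hxA] using hxA.1
      nlinarith
    · have h3 : q x = 0 := Set.indicator_of_notMem hxA _
      rw [h3]; simp
  have hzero : ∫ x, (q x ^ 2 - b * q x) ∂torusMeasure k = 0 := by
    refine le_antisymm ?_ (integral_nonneg hpos)
    rw [integral_sub i2 (i1.const_mul b)]
    linarith
  rw [integral_eq_zero_iff_of_nonneg hpos (i2.sub (i1.const_mul b))] at hzero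
  filter_upwards [hzero, hγe] with x h3 h4
  rw [h4]
  intro hxA
  have h5 : q x = ‖γ x‖ ^ 2 := Set.indicator_of_mem (show x ∈ A from hxA) _
  have h6 : q x ^ 2 - b * q x = 0 := h3
  have h7 : b < q x := by rw [h5]; exact hxA.1
  nlinarith

end BoundedFibers

/-! ### Finite-rank operators attached to two finite families. -/

section FiniteFamilies

variable {E : Type*} [NormedAddCommGroup E] [InnerProductSpace ℂ E] {n : ℕ}

/-- The operator `ξ ↦ ∑ ⟨ξ, v i⟩ u i`. -/
def pairOp (u v : Fin n → E) : E →L[ℂ] E := ∑ i, InnerProductSpace.rankOne ℂ (u i) (v i)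

theorem pairOp_apply (u v : Fin n → E) (ξ : E) : pairOp u v ξ = ∑ i, inner ℂ (v i) ξ • u i := by
  simp [pairOp]

theorem inner_pairOp_left (u v : Fin n → E) (ξ η : E) :
    inner ℂ (pairOp u v ξ) η = inner ℂ ξ (pairOp v u η) := by
  simp only [pairOp_apply, sum_inner, inner_sum, inner_smul_left, inner_smul_right, inner_conj_symm]
  exact Finset.sum_congr rfl fun i _ => mul_comm _ _

theorem norm_pairOp_le (u v : Fin n → E) : ‖pairOp u v‖ ≤ ∑ i, ‖u i‖ * ‖v i‖ := by
  refine ContinuousLinearMap.opNorm_le_bound _ (by positivity) fun ξ => ?_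
  rw [pairOp_apply, Finset.sum_mul]
  refine norm_sum_le_of_le _ fun i _ => ?_
  rw [norm_smul]
  have := norm_inner_le_norm (𝕜 := ℂ) (v i) ξ
  nlinarith [norm_nonneg (u i)]

end FiniteFamilies

/-! ### Fiber fields of shift-preserving operators. -/

section FiberFields

open ContinuousLinearMap

variable {k n : ℕ}

/-- The fibers over `x` of a finite family. -/
def fibers (G : Fin n → L2 k) (x : Rk k) : Fin n → FiberSpace k := fun i => fiber (G i) x

/-- The operator `f ↦ ∑ ⟨f, T_l (H i)⟩ T_l (G i)` attached to two families of generators. -/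
def mixedOperator (G H : Fin n → L2 k) : L2 k →L[ℂ] L2 k :=
  synthesis (translates G) ∘L adjoint (synthesis (translates H))

theorem mixedOperator_self (G : Fin n → L2 k) : mixedOperator G G = frameOperator (translates G) :=
  rfl

theorem adjoint_mixedOperator (G H : Fin n → L2 k) :
    adjoint (mixedOperator G H) = mixedOperator H G := by
  rw [mixedOperator, adjoint_comp, adjoint_adjoint, mixedOperator]

theorem exists_norm_fibers_le {G : Fin n → L2 k} (hG : IsBessel (translates G)) :
    ∃ C : ℝ, 0 ≤ C ∧ ∀ᵐ x ∂torusMeasure k, ∀ i, ‖fibers G x i‖ ≤ C := by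
  choose C hC using hG.hasBoundedFibers
  refine ⟨∑ i, |C i|, by positivity, ?_⟩
  filter_upwards [ae_all_iff.2 hC] with x hx i
  exact (hx i).trans ((le_abs_self _).trans
    (Finset.single_le_sum (f := fun i => |C i|) (fun i _ => abs_nonneg _) (Finset.mem_univ i)))

theorem exists_norm_pairOp_le {G H : Fin n → L2 k} (hG : IsBessel (translates G))
    (hH : IsBessel (translates H)) :
    ∃ C : ℝ, 0 ≤ C ∧ ∀ᵐ x ∂torusMeasure k, ‖pairOp (fibers G x) (fibers H x)‖ ≤ C := by
  obtain ⟨C, hC0, hC⟩ := exists_norm_fibers_le hG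
  obtain ⟨D, hD0, hD⟩ := exists_norm_fibers_le hH
  refine ⟨∑ _i : Fin n, C * D, by positivity, ?_⟩
  filter_upwards [hC, hD] with x h1 h2
  refine (norm_pairOp_le _ _).trans (Finset.sum_le_sum fun i _ => ?_)
  exact mul_le_mul (h1 i) (h2 i) (norm_nonneg _) hC0

theorem aestronglyMeasurable_pairOp (G H : Fin n → L2 k) {Φ : Rk k → FiberSpace k}
    (hΦ : AEStronglyMeasurable Φ (torusMeasure k)) :
    AEStronglyMeasurable (fun x => pairOp (fibers G x) (fibers H x) (Φ x)) (torusMeasure k) := by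
  simp only [pairOp_apply]
  refine Finset.aestronglyMeasurable_fun_sum _ fun i _ => ?_
  exact ((aestronglyMeasurable_fiber (H i)).inner (𝕜 := ℂ) hΦ).smul
    (aestronglyMeasurable_fiber (G i))

theorem eq_sum_of_hasSum_prod {ι : Type*} {a : ι × Fin n → ℂ} {s : ℂ} (h : HasSum a s)
    {b : Fin n → ℂ} (hb : ∀ i, HasSum (fun l => a (l, i)) (b i)) : s = ∑ i, b i := by
  have h2 := (Equiv.prodComm (Fin n) ι).hasSum_iff.2 h
  exact (h2.prod_fiberwise hb).unique (hasSum_fintype b)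

/-- The sum over the lattice is evaluated by Parseval, one generator at a time; bounded fibers
supply the square-integrability it needs. -/
theorem inner_mixedOperator {G H : Fin n → L2 k} (hG : IsBessel (translates G))
    (hH : IsBessel (translates H)) (f' f : L2 k) :
    inner ℂ f' (mixedOperator G H f) =
      ∫ x, inner ℂ (fiber f' x) (pairOp (fibers G x) (fibers H x) (fiber f x))
        ∂torusMeasure k := by
  have h1 : HasSum (fun p : (Fin k → ℤ) × Fin n =>
      inner ℂ (translates H p) f * inner ℂ f' (translates G p))
      (inner ℂ f' (mixedOperator G H f)) := by
    have := (hG.hasSum_synthesis (adjoint (synthesis (translates H)) f)).mapL (innerSL ℂ f')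
    simp only [innerSL_apply_apply, inner_smul_right, hH.adjoint_synthesis_apply] at this
    rw [mixedOperator, comp_apply]
    exact this
  have h3 : ∀ i, HasSum (fun l => inner ℂ (translates H (l, i)) f * inner ℂ f' (translates G (l, i)))
      (∫ x, inner ℂ (fiber f' x) (fiber (G i) x) * inner ℂ (fiber (H i) x) (fiber f x)
        ∂torusMeasure k) := fun i => by
    have := hasSum_inner_translate ((hH.hasBoundedFibers i).memLp_inner f)
      ((hG.hasBoundedFibers i).memLp_inner f')
    simpa only [inner_conj_symm, mul_comm, translates] using this
  have h4 := eq_sum_of_hasSum_prod h1 h3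
  rw [h4, ← integral_finsetSum]
  · refine integral_congr_ae (Filter.Eventually.of_forall fun x => ?_)
    simp only [pairOp_apply, inner_sum, inner_smul_right, fibers]
    exact Finset.sum_congr rfl fun i _ => mul_comm _ _
  · intro i _
    have a1 := (hH.hasBoundedFibers i).memLp_inner f
    have a2 := (hG.hasBoundedFibers i).memLp_inner f'
    have a3 := a2.star
    refine (a3.integrable_mul a1).congr (Filter.Eventually.of_forall fun x => ?_)
    simp only [Pi.mul_apply, Pi.star_apply, RCLike.star_def, inner_conj_symm]

theorem isFiberField_mixedOperator {G H : Fin n → L2 k} (hG : IsBessel (translates G))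
    (hH : IsBessel (translates H)) :
    IsFiberField (mixedOperator G H) fun x => pairOp (fibers G x) (fibers H x) := by
  obtain ⟨C, hC0, hC⟩ := exists_norm_pairOp_le hG hH
  refine ⟨fun ξ η => ?_, ⟨C, hC⟩, fun f => ?_⟩
  · exact (aestronglyMeasurable_const.inner
      (aestronglyMeasurable_pairOp G H aestronglyMeasurable_const)).aemeasurable
  · have hL : MemLp (fun x => pairOp (fibers G x) (fibers H x) (fiber f x)) 2
        (torusMeasure k) := by
      refine (memLp_fiber f).of_le_mul (c := C)
        (aestronglyMeasurable_pairOp G H (aestronglyMeasurable_fiber f)) ?_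
      filter_upwards [hC] with x hx
      exact (le_opNorm _ _).trans (by gcongr)
    obtain ⟨g, hg⟩ := exists_fiber_eq hL
    have : mixedOperator G H f = g := by
      refine ext_inner_left ℂ fun f' => ?_
      rw [inner_mixedOperator hG hH, inner_eq_integral_fiber]
      refine integral_congr_ae ?_
      filter_upwards [hg] with x hx
      rw [hx]
    rw [this]
    exact hg.symm

theorem exists_fiber_eq_const (ξ : FiberSpace k) :
    ∃ f : L2 k, ∀ᵐ x ∂torusMeasure k, fiber f x = ξ :=
  exists_fiber_eq (memLp_const ξ)

/-- Each coordinate vector of `ℓ²(ℤᵏ)` is the constant fiber of some function. There are countably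
many of them, so a single null set serves for all. -/
theorem IsFiberField.ae_eq {S : L2 k →L[ℂ] L2 k}
    {s t : Rk k → FiberSpace k →L[ℂ] FiberSpace k} (hs : IsFiberField S s)
    (ht : IsFiberField S t) : s =ᵐ[torusMeasure k] t := by
  choose f hf using fun l : Fin k → ℤ => exists_fiber_eq_const (unitVec l)
  have h : ∀ l, ∀ᵐ x ∂torusMeasure k, s x (unitVec l) = t x (unitVec l) := fun l => by
    filter_upwards [hf l, hs.2.2 (f l), ht.2.2 (f l)] with x h1 h2 h3
    rw [← h1, h2, h3]
  filter_upwards [ae_all_iff.2 h] with x hx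
  exact clm_ext_unitVec hx

theorem isFiberField_fiberOperator {S : L2 k →L[ℂ] L2 k}
    {s : Rk k → FiberSpace k →L[ℂ] FiberSpace k} (hs : IsFiberField S s) :
    fiberOperator S =ᵐ[torusMeasure k] s := by
  have h : ∃ s, IsFiberField S s := ⟨s, hs⟩
  rw [fiberOperator, dif_pos h]
  exact h.choose_spec.ae_eq hs

theorem IsFiberField.operator_eq {S T : L2 k →L[ℂ] L2 k}
    {s t : Rk k → FiberSpace k →L[ℂ] FiberSpace k} (hs : IsFiberField S s)
    (ht : IsFiberField T t) (hst : s =ᵐ[torusMeasure k] t) : S = T := by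
  ext1 f
  refine eq_of_fiber_ae_eq ?_
  filter_upwards [hs.2.2 f, ht.2.2 f, hst] with x h1 h2 h3
  rw [← h1, ← h2, h3]

theorem IsFiberField.zero : IsFiberField (0 : L2 k →L[ℂ] L2 k) fun _ => 0 := by
  refine ⟨fun ξ η => ?_, ⟨0, by simp⟩, fun f => ?_⟩
  · simp
  · have h := fiber_smul (0 : ℂ) f
    filter_upwards [h] with x hx
    rw [zero_smul, zero_smul] at hx
    simp [hx]

theorem IsFiberField.smul {S : L2 k →L[ℂ] L2 k}
    {s : Rk k → FiberSpace k →L[ℂ] FiberSpace k} (hs : IsFiberField S s) (c : ℂ) :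
    IsFiberField (c • S) fun x => c • s x := by
  obtain ⟨h1, ⟨C, hC⟩, h3⟩ := hs
  refine ⟨fun ξ η => ?_, ⟨‖c‖ * C, ?_⟩, fun f => ?_⟩
  · simp only [smul_apply, inner_smul_right]
    exact (h1 ξ η).const_mul c
  · filter_upwards [hC] with x hx
    rw [norm_smul]; gcongr
  · filter_upwards [h3 f, fiber_smul c (S f)] with x h4 h5
    rw [smul_apply, smul_apply, h4, h5]

theorem fiber_sub (f g : L2 k) :
    ∀ᵐ x ∂torusMeasure k, fiber (f - g) x = fiber f x - fiber g x := by
  filter_upwards [fiber_add (f - g) g] with x hx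
  rw [sub_add_cancel] at hx
  rw [hx, add_sub_cancel_right]

theorem IsFiberField.sub {S T : L2 k →L[ℂ] L2 k}
    {s t : Rk k → FiberSpace k →L[ℂ] FiberSpace k} (hs : IsFiberField S s)
    (ht : IsFiberField T t) : IsFiberField (S - T) fun x => s x - t x := by
  obtain ⟨h1, ⟨C, hC⟩, h3⟩ := hs
  obtain ⟨h1', ⟨C', hC'⟩, h3'⟩ := ht
  refine ⟨fun ξ η => ?_, ⟨C + C', ?_⟩, fun f => ?_⟩
  · simp only [sub_apply, inner_sub_right]
    exact (h1 ξ η).sub (h1' ξ η)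
  · filter_upwards [hC, hC'] with x hx hx'
    exact (norm_sub_le _ _).trans (add_le_add hx hx')
  · filter_upwards [h3 f, h3' f, fiber_sub (S f) (T f)] with x h4 h5 h6
    rw [sub_apply, sub_apply, h4, h5, h6]

/-- The fibers of a positive operator are positive. -/
theorem IsFiberField.isPositive {S : L2 k →L[ℂ] L2 k}
    {s : Rk k → FiberSpace k →L[ℂ] FiberSpace k} (hs : IsFiberField S s) (hS : S.IsPositive) :
    ∀ᵐ x ∂torusMeasure k, (s x).IsPositive := by
  -- The function with fibers `ξ` on `A` and `0` elsewhere localizes the quadratic form of `S` to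
  -- `A`.
  have hint : ∀ (ξ : FiberSpace k) (A : Set (Rk k)), MeasurableSet A →
      Integrable (fun x => inner ℂ (s x ξ) ξ) (torusMeasure k) ∧
      ∃ f : L2 k, ∫ x in A, inner ℂ (s x ξ) ξ ∂torusMeasure k = inner ℂ (S f) f := by
    intro ξ A hA
    obtain ⟨C, hC⟩ := hs.2.1
    constructor
    · have hm : AEMeasurable (fun x => inner ℂ (s x ξ) ξ) (torusMeasure k) := by
        have := Complex.continuous_conj.measurable.comp_aemeasurable (hs.1 ξ ξ)
        refine this.congr (Filter.Eventually.of_forall fun x => ?_)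
        exact inner_conj_symm _ _
      refine Integrable.of_bound hm.aestronglyMeasurable (C * ‖ξ‖ * ‖ξ‖) ?_
      filter_upwards [hC] with x hx
      refine (norm_inner_le_norm _ _).trans ?_
      gcongr
      exact (le_opNorm _ _).trans (by gcongr)
    · obtain ⟨f, hf⟩ := exists_fiber_eq ((memLp_const (μ := torusMeasure k) ξ).indicator hA)
      refine ⟨f, ?_⟩
      rw [inner_eq_integral_fiber, ← integral_indicator hA]
      refine integral_congr_ae ?_
      filter_upwards [hf, hs.2.2 f] with x h1 h2
      rw [← h2, h1]
      by_cases hx : x ∈ A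
      · rw [Set.indicator_of_mem hx, Set.indicator_of_mem hx]
      · rw [Set.indicator_of_notMem hx, Set.indicator_of_notMem hx, inner_zero_right]
  rw [isPositive_iff_complex] at hS
  have hval : ∀ ξ : FiberSpace k, ∀ᵐ x ∂torusMeasure k,
      0 ≤ (inner ℂ (s x ξ) ξ).re ∧ (inner ℂ (s x ξ) ξ).im = 0 := by
    intro ξ
    have hi := (hint ξ Set.univ MeasurableSet.univ).1
    have him : ∀ A, MeasurableSet A →
        ∫ x in A, RCLike.im (inner ℂ (s x ξ) ξ) ∂torusMeasure k = 0 := fun A hA => by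
      obtain ⟨f, hf⟩ := (hint ξ A hA).2
      rw [integral_im hi.integrableOn, hf, ← (hS f).1]
      exact Complex.ofReal_im (RCLike.re (inner ℂ (S f) f))
    have h1 := ae_nonneg_of_forall_setIntegral_nonneg hi.re fun A hA _ => by
      obtain ⟨f, hf⟩ := (hint ξ A hA).2
      rw [integral_re hi.integrableOn, hf]
      exact (hS f).2
    have h2 := ae_nonneg_of_forall_setIntegral_nonneg hi.im fun A hA _ => (him A hA).ge
    have h3 := ae_nonneg_of_forall_setIntegral_nonneg hi.im.neg fun A hA _ => by
      simp only [Pi.neg_apply]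
      rw [integral_neg, him A hA, neg_zero]
    filter_upwards [h1, h2, h3] with x h4 h5 h6
    exact ⟨h4, le_antisymm (by simpa using h6) h5⟩
  -- The null set in `hval` depends on `ξ`; a countable dense set of vectors and continuity remove
  -- this dependence.
  have hdense := ae_all_iff.2 fun m : ℕ => hval (TopologicalSpace.denseSeq (FiberSpace k) m)
  filter_upwards [hdense] with x hx
  have hcont : Continuous fun ξ => inner ℂ (s x ξ) ξ := (s x).continuous.inner continuous_id
  have hclosed : IsClosed {ξ | 0 ≤ (inner ℂ (s x ξ) ξ).re ∧ (inner ℂ (s x ξ) ξ).im = 0} :=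
    (isClosed_le continuous_const (Complex.continuous_re.comp hcont)).inter
      (isClosed_eq (Complex.continuous_im.comp hcont) continuous_const)
  have hall : ∀ ξ, 0 ≤ (inner ℂ (s x ξ) ξ).re ∧ (inner ℂ (s x ξ) ξ).im = 0 := fun ξ =>
    (TopologicalSpace.denseRange_denseSeq (FiberSpace k)).induction_on
      (p := fun ξ => 0 ≤ (inner ℂ (s x ξ) ξ).re ∧ (inner ℂ (s x ξ) ξ).im = 0) ξ hclosed hx
  rw [isPositive_iff_complex]
  exact fun ξ => ⟨Complex.ext rfl (hall ξ).2.symm, (hall ξ).1⟩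

end FiberFields

/-! ### Measurable factorization of a positive matrix through a projection. -/

section MatrixFactorization

open Matrix
open scoped ComplexOrder

variable {n : ℕ}

open Classical in
/-- The first column of `N` with nonzero diagonal entry, divided by the square root of that
entry. -/
def pivotCol (N : Matrix (Fin n) (Fin n) ℂ) : Fin n → ℂ := fun i =>
  ∑ j, if N j j ≠ 0 ∧ ∀ m < j, N m m = 0 then N i j / (Real.sqrt (N j j).re : ℂ) else 0

theorem pivotCol_eq_of_pivot {N : Matrix (Fin n) (Fin n) ℂ} {j : Fin n} (hj : N j j ≠ 0)
    (hlt : ∀ m < j, N m m = 0) (i : Fin n) :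
    pivotCol N i = N i j / (Real.sqrt (N j j).re : ℂ) := by
  classical
  rw [pivotCol, Finset.sum_eq_single j]
  · rw [if_pos ⟨hj, hlt⟩]
  · rintro b - hb
    rw [if_neg]
    rintro ⟨h1, h2⟩
    rcases lt_or_gt_of_ne hb with h | h
    · exact h1 (hlt b h)
    · exact hj (h2 j h)
  · simp

theorem pivotCol_zero : pivotCol (0 : Matrix (Fin n) (Fin n) ℂ) = 0 := by
  ext i; simp [pivotCol]

theorem exists_pivot {N : Matrix (Fin n) (Fin n) ℂ} (hN : N.PosSemidef) (h0 : N ≠ 0) :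
    ∃ j, N j j ≠ 0 ∧ ∀ m < j, N m m = 0 := by
  classical
  have h : ∃ j, N j j ≠ 0 := by
    by_contra! h
    exact h0 (hN.trace_eq_zero_iff.1 (Finset.sum_eq_zero fun j _ => h j))
  have hne : (Finset.univ.filter fun j => N j j ≠ 0).Nonempty := by
    obtain ⟨j, hj⟩ := h
    exact ⟨j, by simp [hj]⟩
  refine ⟨_, (Finset.mem_filter.1 (Finset.min'_mem _ hne)).2, fun m hm => ?_⟩
  by_contra hm0
  exact absurd (Finset.min'_le _ m (by simp [hm0])) (not_le.2 hm)

/-- `N` with its pivot column removed. -/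
def deflate (N : Matrix (Fin n) (Fin n) ℂ) : Matrix (Fin n) (Fin n) ℂ :=
  N - vecMulVec (pivotCol N) (star (pivotCol N))

theorem deflate_zero : deflate (0 : Matrix (Fin n) (Fin n) ℂ) = 0 := by
  simp [deflate, pivotCol_zero]

theorem pivot_re {N : Matrix (Fin n) (Fin n) ℂ} (hN : N.PosSemidef) {j : Fin n}
    (hj : N j j ≠ 0) : 0 < (N j j).re ∧ ((N j j).re : ℂ) = N j j := by
  have h := hN.diag_nonneg (i := j)
  obtain ⟨h1, h2⟩ := Complex.nonneg_iff.1 h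
  have e : ((N j j).re : ℂ) = N j j := Complex.ext rfl h2
  refine ⟨lt_of_le_of_ne h1 fun h3 => hj ?_, e⟩
  rw [← e, ← h3]; simp

theorem vecMulVec_pivotCol {N : Matrix (Fin n) (Fin n) ℂ} (hN : N.PosSemidef) {j : Fin n}
    (hj : N j j ≠ 0) (hlt : ∀ m < j, N m m = 0) :
    vecMulVec (pivotCol N) (star (pivotCol N)) =
      (N j j)⁻¹ • (N * vecMulVec (Pi.single j 1) (Pi.single j 1) * N) := by
  obtain ⟨hpos, hre⟩ := pivot_re hN hj
  ext a b
  rw [vecMulVec_apply, Pi.star_apply, pivotCol_eq_of_pivot hj hlt, pivotCol_eq_of_pivot hj hlt,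
    mul_vecMulVec, vecMulVec_mul, Matrix.smul_apply, vecMulVec_apply]
  simp only [mulVec_single_one, single_one_vecMul, Matrix.col_apply, Matrix.row_apply, star_div₀,
    smul_eq_mul, hN.isHermitian.apply]
  have h2 : (star (Real.sqrt (N j j).re : ℂ)) = (Real.sqrt (N j j).re : ℂ) := Complex.conj_ofReal _
  have h3 : (Real.sqrt (N j j).re : ℂ) * (Real.sqrt (N j j).re : ℂ) = N j j := by
    rw [← Complex.ofReal_mul, Real.mul_self_sqrt hpos.le, hre]
  rw [h2, div_mul_div_comm, h3, div_eq_inv_mul]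

/-- One step of Gaussian elimination, in two forms: the congruence shows that positivity is kept,
the one-sided product that the kernel does not shrink. -/
theorem deflate_eq_conj {N : Matrix (Fin n) (Fin n) ℂ} (hN : N.PosSemidef) {j : Fin n}
    (hj : N j j ≠ 0) (hlt : ∀ m < j, N m m = 0) :
    deflate N = (1 - (N j j)⁻¹ • (vecMulVec (Pi.single j 1) (Pi.single j 1) * N))ᴴ * N *
      (1 - (N j j)⁻¹ • (vecMulVec (Pi.single j 1) (Pi.single j 1) * N)) ∧
    deflate N = (1 - (N j j)⁻¹ • (vecMulVec (Pi.single j 1) (Pi.single j 1) * N))ᴴ * N := by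
  obtain ⟨hpos, hre⟩ := pivot_re hN hj
  have hD : (vecMulVec (Pi.single j 1) (Pi.single j 1) : Matrix (Fin n) (Fin n) ℂ)ᴴ =
      vecMulVec (Pi.single j 1) (Pi.single j 1) := by
    rw [conjTranspose_vecMulVec, ← Pi.single_star, star_one]
  have hDND : vecMulVec (Pi.single j 1) (Pi.single j 1) * N *
      vecMulVec (Pi.single j 1) (Pi.single j 1) =
      N j j • vecMulVec (Pi.single j 1) (Pi.single j 1) := by
    rw [vecMulVec_mul, vecMulVec_mul_vecMulVec, vecMulVec_smul]
    simp
  have hα : star (N j j)⁻¹ = (N j j)⁻¹ := by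
    rw [star_inv₀, ← hre]; congr 1; exact Complex.conj_ofReal _
  rw [deflate, vecMulVec_pivotCol hN hj hlt]
  generalize (vecMulVec (Pi.single j 1) (Pi.single j 1) : Matrix (Fin n) (Fin n) ℂ) = D at *
  generalize N j j = α at *
  have hC : (1 - α⁻¹ • (D * N))ᴴ = 1 - α⁻¹ • (N * D) := by
    rw [conjTranspose_sub, conjTranspose_one, conjTranspose_smul, conjTranspose_mul, hD,
      hN.isHermitian.eq, hα]
  have h2 : N - α⁻¹ • (N * D * N) = (1 - α⁻¹ • (D * N))ᴴ * N := by
    rw [hC, sub_mul, one_mul, smul_mul_assoc]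
  refine ⟨?_, h2⟩
  rw [← h2, mul_sub, mul_one, sub_mul, mul_smul_comm, smul_mul_assoc]
  have h3 : N * D * N * (D * N) = α • (N * D * N) := by
    calc N * D * N * (D * N) = N * (D * N * D) * N := by simp only [mul_assoc]
      _ = _ := by rw [hDND, mul_smul_comm, smul_mul_assoc]
  rw [mul_smul_comm, h3, smul_smul, smul_smul, mul_assoc α⁻¹, inv_mul_cancel₀ hj, mul_one,
    ← mul_assoc]
  simp

theorem posSemidef_deflate {N : Matrix (Fin n) (Fin n) ℂ} (hN : N.PosSemidef) :
    (deflate N).PosSemidef := by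
  by_cases h0 : N = 0
  · rw [h0, deflate_zero]; exact PosSemidef.zero
  · obtain ⟨j, hj, hlt⟩ := exists_pivot hN h0
    rw [(deflate_eq_conj hN hj hlt).1]
    exact hN.conjTranspose_mul_mul_same _

/-- The kernel grows strictly: the pivot coordinate vector enters it, and it was not there before
because the pivot is nonzero. -/
theorem rank_deflate_lt {N : Matrix (Fin n) (Fin n) ℂ} (hN : N.PosSemidef) (h0 : N ≠ 0) :
    (deflate N).rank < N.rank := by
  obtain ⟨j, hj, hlt⟩ := exists_pivot hN h0
  obtain ⟨hpos, hre⟩ := pivot_re hN hj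
  have hker : LinearMap.ker N.mulVecLin < LinearMap.ker (deflate N).mulVecLin := by
    refine SetLike.lt_iff_le_and_exists.2 ⟨fun x hx => ?_, Pi.single j 1, ?_, fun h => hj ?_⟩
    · rw [LinearMap.mem_ker, mulVecLin_apply] at hx ⊢
      rw [(deflate_eq_conj hN hj hlt).2, ← mulVec_mulVec, hx, mulVec_zero]
    · rw [LinearMap.mem_ker, mulVecLin_apply, deflate, vecMulVec_pivotCol hN hj hlt, sub_mulVec,
        smul_mulVec, ← mulVec_mulVec, ← mulVec_mulVec, vecMulVec_mulVec]
      simp [mulVec_smul, smul_smul, hj]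
    · rw [LinearMap.mem_ker, mulVecLin_apply] at h
      simpa using congrFun h j
  have h1 := LinearMap.finrank_range_add_finrank_ker N.mulVecLin
  have h2 := LinearMap.finrank_range_add_finrank_ker (deflate N).mulVecLin
  have h3 := Submodule.finrank_lt_finrank_of_lt hker
  simp only [Matrix.rank]
  omega

/-- `K` is the matrix of an orthogonal projection. -/
def IsProjMatrix (K : Matrix (Fin n) (Fin n) ℂ) : Prop := Kᴴ = K ∧ K * K = K

theorem IsProjMatrix.posSemidef {K : Matrix (Fin n) (Fin n) ℂ} (hK : IsProjMatrix K) :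
    K.PosSemidef := by
  have := posSemidef_conjTranspose_mul_self K
  rwa [hK.1, hK.2] at this

theorem IsProjMatrix.mulVec_pivotCol {K : Matrix (Fin n) (Fin n) ℂ} (hK : IsProjMatrix K) :
    K *ᵥ pivotCol K = pivotCol K := by
  by_cases h0 : K = 0
  · rw [h0, pivotCol_zero, mulVec_zero]
  · obtain ⟨j, hj, hlt⟩ := exists_pivot hK.posSemidef h0
    have : pivotCol K = (Real.sqrt (K j j).re : ℂ)⁻¹ • (K *ᵥ Pi.single j 1) := by
      ext i
      rw [pivotCol_eq_of_pivot hj hlt]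
      simp [div_eq_inv_mul]
    rw [this, mulVec_smul, mulVec_mulVec, hK.2]

theorem IsProjMatrix.vecMul_star_pivotCol {K : Matrix (Fin n) (Fin n) ℂ} (hK : IsProjMatrix K) :
    star (pivotCol K) ᵥ* K = star (pivotCol K) := by
  have := congrArg star hK.mulVec_pivotCol
  rwa [star_mulVec, hK.1] at this

theorem IsProjMatrix.star_pivotCol_dotProduct {K : Matrix (Fin n) (Fin n) ℂ}
    (hK : IsProjMatrix K) (h0 : K ≠ 0) : star (pivotCol K) ⬝ᵥ pivotCol K = 1 := by
  obtain ⟨j, hj, hlt⟩ := exists_pivot hK.posSemidef h0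
  obtain ⟨hpos, hre⟩ := pivot_re hK.posSemidef hj
  have h1 : ∑ i, K j i * K i j = K j j := congrFun (congrFun hK.2 j) j
  have h2 : (star (Real.sqrt (K j j).re : ℂ)) = (Real.sqrt (K j j).re : ℂ) := Complex.conj_ofReal _
  have h3 : (Real.sqrt (K j j).re : ℂ) * (Real.sqrt (K j j).re : ℂ) = K j j := by
    rw [← Complex.ofReal_mul, Real.mul_self_sqrt hpos.le, hre]
  have hherm : K.IsHermitian := hK.1
  simp only [dotProduct, Pi.star_apply, pivotCol_eq_of_pivot hj hlt, star_div₀, hherm.apply, h2,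
    div_mul_div_comm, h3]
  rw [← Finset.sum_div, h1, div_self hj]

theorem IsProjMatrix.deflate_mulVec_pivotCol {K : Matrix (Fin n) (Fin n) ℂ}
    (hK : IsProjMatrix K) : deflate K *ᵥ pivotCol K = 0 := by
  by_cases h0 : K = 0
  · rw [h0, pivotCol_zero, mulVec_zero]
  · rw [deflate, sub_mulVec, hK.mulVec_pivotCol, vecMulVec_mulVec,
      hK.star_pivotCol_dotProduct h0]
    simp

/-- For a nonzero projection the normalized pivot column is a unit vector of its range, so what is
subtracted is the projection onto that line. -/
theorem IsProjMatrix.deflate {K : Matrix (Fin n) (Fin n) ℂ} (hK : IsProjMatrix K) :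
    IsProjMatrix (deflate K) := by
  have h1 : ObliqueDuals.deflate K * K = ObliqueDuals.deflate K := by
    rw [ObliqueDuals.deflate, sub_mul, hK.2, vecMulVec_mul, hK.vecMul_star_pivotCol]
  refine ⟨?_, ?_⟩
  · rw [ObliqueDuals.deflate, conjTranspose_sub, hK.1, conjTranspose_vecMulVec, star_star]
  · conv_lhs => rw [ObliqueDuals.deflate.eq_1 K, mul_sub]
    rw [← ObliqueDuals.deflate.eq_1, h1, mul_vecMulVec, hK.deflate_mulVec_pivotCol]
    simp

theorem matrix_rank_add_le (A B : Matrix (Fin n) (Fin n) ℂ) :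
    (A + B).rank ≤ A.rank + B.rank := by
  have h1 : LinearMap.range (A + B).mulVecLin ≤
      LinearMap.range A.mulVecLin ⊔ LinearMap.range B.mulVecLin := by
    rw [mulVecLin_add]
    exact LinearMap.range_add_le _ _
  exact (Submodule.finrank_mono h1).trans (Submodule.finrank_add_le_finrank_add_finrank _ _)

theorem rank_le_rank_deflate_add_one (K : Matrix (Fin n) (Fin n) ℂ) :
    K.rank ≤ (deflate K).rank + 1 := by
  have h := matrix_rank_add_le (deflate K) (vecMulVec (pivotCol K) (star (pivotCol K)))
  have h1 := rank_vecMulVec_le (pivotCol K) (star (pivotCol K))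
  have h2 : deflate K + vecMulVec (pivotCol K) (star (pivotCol K)) = K := sub_add_cancel _ _
  rw [h2] at h
  omega

/-- A measurable choice of a factor `M` with `M Mᴴ = N` and `M K = M`. -/
def factor : ℕ → Matrix (Fin n) (Fin n) ℂ → Matrix (Fin n) (Fin n) ℂ → Matrix (Fin n) (Fin n) ℂ
  | 0, _, _ => 0
  | m + 1, N, K => vecMulVec (pivotCol N) (star (pivotCol K)) + factor m (deflate N) (deflate K)

/-- Here `M = ∑ v wᴴ`, where the `v` are the pivot columns met while eliminating `N` and the `w`
those met while eliminating `K`. As long as they are nonzero the `w` are orthonormal in the range of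
`K`, so `M Mᴴ = ∑ v vᴴ = N` and `M K = M`. Each step lowers the rank of a nonzero `N` by at least
one and that of `K` by at most one, so the `w` do not run out before the `v`. -/
theorem factor_spec (m : ℕ) : ∀ {N K : Matrix (Fin n) (Fin n) ℂ}, N.PosSemidef → IsProjMatrix K →
    N.rank ≤ K.rank → N.rank ≤ m →
    factor m N K * (factor m N K)ᴴ = N ∧ factor m N K * K = factor m N K := by
  induction m with
  | zero =>
    intro N K hN hK hr hm
    have hN0 : N = 0 := by
      by_contra h0
      have := rank_deflate_lt hN h0
      omega
    simp [factor, hN0]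
  | succ m ih =>
    intro N K hN hK hr hm
    have hranks : (deflate N).rank ≤ (deflate K).rank ∧ (deflate N).rank ≤ m := by
      by_cases h0 : N = 0
      · rw [h0, deflate_zero, rank_zero]; simp
      · have h1 := rank_deflate_lt hN h0
        have h2 := rank_le_rank_deflate_add_one K
        omega
    obtain ⟨e1, e2⟩ := ih (posSemidef_deflate hN) hK.deflate hranks.1 hranks.2
    have hv : vecMulVec (pivotCol N) (star (pivotCol K)) * (vecMulVec (pivotCol N)
        (star (pivotCol K)))ᴴ = vecMulVec (pivotCol N) (star (pivotCol N)) := by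
      rw [conjTranspose_vecMulVec, star_star, vecMulVec_mul_vecMulVec]
      by_cases h0 : N = 0
      · rw [h0, pivotCol_zero]; simp
      · have hK0 : K ≠ 0 := by
          rintro rfl
          have := rank_deflate_lt hN h0
          rw [rank_zero] at hr
          omega
        rw [hK.star_pivotCol_dotProduct hK0, one_smul]
    rw [factor]
    generalize factor m (deflate N) (deflate K) = M at e1 e2
    have hMw : M *ᵥ pivotCol K = 0 := by
      rw [← e2, ← mulVec_mulVec, hK.deflate_mulVec_pivotCol, mulVec_zero]
    have hMV : M * (vecMulVec (pivotCol N) (star (pivotCol K)))ᴴ = 0 := by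
      rw [conjTranspose_vecMulVec, star_star, mul_vecMulVec, hMw, zero_vecMulVec]
    have hVM : vecMulVec (pivotCol N) (star (pivotCol K)) * Mᴴ = 0 := by
      have := congrArg conjTranspose hMV
      rwa [conjTranspose_mul, conjTranspose_conjTranspose, conjTranspose_zero] at this
    constructor
    · rw [conjTranspose_add, add_mul, mul_add, mul_add, hv, hMV, hVM, e1, deflate]
      abel
    · rw [add_mul, vecMulVec_mul, hK.vecMul_star_pivotCol]
      congr 1
      have hK' : K = deflate K + vecMulVec (pivotCol K) (star (pivotCol K)) := by
        rw [deflate, sub_add_cancel]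
      rw [hK', mul_add, e2, mul_vecMulVec, hMw, zero_vecMulVec, add_zero]

/-- This is why the pivot is the first nonzero diagonal entry: the choice is a finite case
distinction on measurable conditions, so no selection theorem is needed. -/
theorem measurable_pivotCol {X : Type*} [MeasurableSpace X]
    {N : X → Matrix (Fin n) (Fin n) ℂ} (hN : ∀ i j, Measurable fun x => N x i j) (i : Fin n) :
    Measurable fun x => pivotCol (N x) i := by
  classical
  unfold pivotCol
  refine Finset.measurable_sum _ fun j _ => Measurable.ite ?_ ?_ measurable_const
  · have h1 : MeasurableSet {x | N x j j ≠ 0} :=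
      (hN j j) (measurableSet_singleton (0 : ℂ)).compl
    have h2 : MeasurableSet {x | ∀ m < j, N x m m = 0} := by
      have : {x | ∀ m < j, N x m m = 0} = ⋂ m, ⋂ (_ : m < j), {x | N x m m = 0} := by
        ext x; simp
      rw [this]
      exact MeasurableSet.iInter fun m => MeasurableSet.iInter fun _ =>
        (hN m m) (measurableSet_singleton (0 : ℂ))
    exact h1.inter h2
  · exact (hN i j).div (Complex.measurable_ofReal.comp
      (Real.continuous_sqrt.measurable.comp (Complex.measurable_re.comp (hN j j))))

theorem measurable_deflate {X : Type*} [MeasurableSpace X]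
    {N : X → Matrix (Fin n) (Fin n) ℂ} (hN : ∀ i j, Measurable fun x => N x i j) (i j : Fin n) :
    Measurable fun x => deflate (N x) i j := by
  simp only [deflate, Matrix.sub_apply, vecMulVec_apply, Pi.star_apply]
  exact (hN i j).sub ((measurable_pivotCol hN i).mul
    (Complex.continuous_conj.measurable.comp (measurable_pivotCol hN j)))

theorem measurable_factor {X : Type*} [MeasurableSpace X] (m : ℕ) :
    ∀ {N K : X → Matrix (Fin n) (Fin n) ℂ}, (∀ i j, Measurable fun x => N x i j) →
      (∀ i j, Measurable fun x => K x i j) →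
      ∀ i j, Measurable fun x => factor m (N x) (K x) i j := by
  induction m with
  | zero => intro N K _ _ i j; simp [factor]
  | succ m ih =>
    intro N K hN hK i j
    simp only [factor, Matrix.add_apply, vecMulVec_apply, Pi.star_apply]
    exact ((measurable_pivotCol hN i).mul (Complex.continuous_conj.measurable.comp
      (measurable_pivotCol hK j))).add (ih (measurable_deflate hN) (measurable_deflate hK) i j)

theorem aemeasurable_factor {X : Type*} [MeasurableSpace X] {μ : Measure X} (m : ℕ)
    {N K : X → Matrix (Fin n) (Fin n) ℂ} (hN : ∀ i j, AEMeasurable (fun x => N x i j) μ)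
    (hK : ∀ i j, AEMeasurable (fun x => K x i j) μ) (i j : Fin n) :
    AEMeasurable (fun x => factor m (N x) (K x) i j) μ := by
  refine ⟨fun x => factor m (Matrix.of fun i j => (hN i j).mk _ x)
    (Matrix.of fun i j => (hK i j).mk _ x) i j,
    measurable_factor m (fun i j => (hN i j).measurable_mk) (fun i j => (hK i j).measurable_mk)
      i j, ?_⟩
  filter_upwards [ae_all_iff.2 fun i => ae_all_iff.2 fun j => (hN i j).ae_eq_mk,
    ae_all_iff.2 fun i => ae_all_iff.2 fun j => (hK i j).ae_eq_mk] with x h1 h2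
  congr 2
  · ext a b; exact h1 a b
  · ext a b; exact h2 a b

end MatrixFactorization

/-! ### Linear algebra in a single fiber: rank bounds and the factorization of the defect. -/

section FiniteFamilyRanks

open Matrix
open scoped ComplexOrder

variable {E : Type*} [NormedAddCommGroup E] [InnerProductSpace ℂ E] {n : ℕ}

/-- The analysis map `ξ ↦ (⟨ξ, u i⟩)_i`. -/
def analysisMap (u : Fin n → E) : E →ₗ[ℂ] (Fin n → ℂ) :=
  LinearMap.pi fun i => (innerSL ℂ (u i)).toLinearMap

theorem analysisMap_apply (u : Fin n → E) (ξ : E) (i : Fin n) :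
    analysisMap u ξ i = inner ℂ (u i) ξ := rfl

theorem pairOp_eq (u v : Fin n → E) (ξ : E) :
    pairOp u v ξ = Fintype.linearCombination ℂ u (analysisMap v ξ) := by
  rw [pairOp_apply, Fintype.linearCombination_apply]; rfl

theorem pairOp_apply_mem (u v : Fin n → E) (ξ : E) :
    pairOp u v ξ ∈ Submodule.span ℂ (Set.range u) := by
  rw [pairOp_eq, ← Fintype.range_linearCombination]
  exact LinearMap.mem_range_self _ _

theorem apply_eq_self_of_mem_span {u : Fin n → E} {T : E →L[ℂ] E} (hT : ∀ i, T (u i) = u i)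
    {ξ : E} (hξ : ξ ∈ Submodule.span ℂ (Set.range u)) : T ξ = ξ := by
  induction hξ using Submodule.span_induction with
  | mem x hx => obtain ⟨i, rfl⟩ := hx; exact hT i
  | zero => exact map_zero T
  | add x y _ _ hx hy => rw [map_add, hx, hy]
  | smul c x _ hx => rw [map_smul, hx]

/-- Every vector of the span is rebuilt by `φ` from its coefficients against `f`. -/
theorem finrank_span_le_finrank_range_analysisMap {φ f : Fin n → E}
    (h : ∀ i, pairOp φ f (φ i) = φ i) :
    Module.finrank ℂ (Submodule.span ℂ (Set.range φ)) ≤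
      Module.finrank ℂ (LinearMap.range (analysisMap f)) := by
  have h1 : Submodule.span ℂ (Set.range φ) ≤
      (LinearMap.range (analysisMap f)).map (Fintype.linearCombination ℂ φ) := fun ξ hξ => by
    rw [← apply_eq_self_of_mem_span h hξ, pairOp_eq]
    exact Submodule.mem_map_of_mem (LinearMap.mem_range_self _ _)
  exact (Submodule.finrank_mono h1).trans (Submodule.finrank_map_le _ _)

/-- A family annihilated by the analysis coefficients of `f` has small rank. -/
theorem rank_pairOp_self_le {φ f r : Fin n → E} (h : ∀ i, pairOp φ f (φ i) = φ i)
    (hr : ∀ ξ, pairOp r f ξ = 0) (hrφ : ∀ i, r i ∈ Submodule.span ℂ (Set.range φ)) :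
    LinearMap.rank (pairOp r r).toLinearMap ≤
      ((min (Module.finrank ℂ (Submodule.span ℂ (Set.range φ)))
        (n - Module.finrank ℂ (Submodule.span ℂ (Set.range φ))) : ℕ) : Cardinal) := by
  have h1 : LinearMap.range (pairOp r r).toLinearMap ≤ Submodule.span ℂ (Set.range r) := by
    rintro _ ⟨ξ, rfl⟩
    exact pairOp_apply_mem r r ξ
  have hfin : FiniteDimensional ℂ (Submodule.span ℂ (Set.range r)) :=
    FiniteDimensional.span_of_finite ℂ (Set.finite_range r)
  refine (Submodule.rank_mono h1).trans ?_
  rw [← Module.finrank_eq_rank, Nat.cast_le, le_min_iff]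
  constructor
  · have : FiniteDimensional ℂ (Submodule.span ℂ (Set.range φ)) :=
      FiniteDimensional.span_of_finite ℂ (Set.finite_range φ)
    refine Submodule.finrank_mono (Submodule.span_le.2 ?_)
    rintro _ ⟨i, rfl⟩
    exact hrφ i
  -- Synthesis by `r` kills a subspace of `ℂⁿ` of dimension at least that of the span of `φ`;
  -- rank-nullity bounds the rest.
  · have h2 : LinearMap.range (analysisMap f) ≤
        LinearMap.ker (Fintype.linearCombination ℂ r) := by
      rintro _ ⟨ξ, rfl⟩
      rw [LinearMap.mem_ker, ← pairOp_eq, hr]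
    have h3 := Submodule.finrank_mono h2
    have h4 := finrank_span_le_finrank_range_analysisMap h
    have h5 := LinearMap.finrank_range_add_finrank_ker (Fintype.linearCombination ℂ r)
    rw [Fintype.range_linearCombination, Module.finrank_fin_fun] at h5
    omega

/-- The matrix with entries `⟨v j, u i⟩`. -/
def crossGram (u v : Fin n → E) : Matrix (Fin n) (Fin n) ℂ := Matrix.of fun i j => inner ℂ (u i) (v j)

theorem crossGram_apply (u v : Fin n → E) (i j : Fin n) : crossGram u v i j = inner ℂ (u i) (v j) :=
  rfl

theorem rank_crossGram_le {u v : Fin n → E} {p : Submodule ℂ E} [FiniteDimensional ℂ p]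
    (h : ∀ j, ∃ ξ ∈ p, analysisMap u ξ = analysisMap u (v j)) :
    (crossGram u v).rank ≤ Module.finrank ℂ p := by
  rw [Matrix.rank_eq_finrank_span_cols]
  refine (Submodule.finrank_mono (t := p.map (analysisMap u)) (Submodule.span_le.2 ?_)).trans
    (Submodule.finrank_map_le _ _)
  rintro _ ⟨j, rfl⟩
  obtain ⟨ξ, hξ, he⟩ := h j
  exact ⟨ξ, hξ, he⟩

theorem crossGram_mulVec (u v : Fin n → E) (a : Fin n → ℂ) :
    crossGram u v *ᵥ a = analysisMap u (Fintype.linearCombination ℂ v a) := by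
  ext i
  rw [analysisMap_apply, Fintype.linearCombination_apply, inner_sum]
  simp only [mulVec, dotProduct, crossGram_apply, inner_smul_right]
  exact Finset.sum_congr rfl fun j _ => mul_comm _ _

theorem posSemidef_crossGram {A : E →L[ℂ] E} (hA : A.IsPositive) (u : Fin n → E) :
    (crossGram u fun j => A (u j)).PosSemidef := by
  refine PosSemidef.of_dotProduct_mulVec_nonneg ?_ fun a => ?_
  · ext i j
    rw [conjTranspose_apply, crossGram_apply, crossGram_apply, RCLike.star_def, inner_conj_symm]
    exact hA.isSymmetric _ _
  · have : star a ⬝ᵥ crossGram u (fun j => A (u j)) *ᵥ a =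
        inner ℂ (Fintype.linearCombination ℂ u a) (A (Fintype.linearCombination ℂ u a)) := by
      rw [crossGram_mulVec]
      simp only [Fintype.linearCombination_apply, map_sum, map_smul, sum_inner, inner_smul_left,
        dotProduct, Pi.star_apply, analysisMap_apply, RCLike.star_def]
    rw [this]
    exact hA.inner_nonneg_right _

/-- The complementary projection of the coefficient space attached to a frame and its dual. -/
def kernelMatrix (f f' : Fin n → E) : Matrix (Fin n) (Fin n) ℂ := 1 - crossGram f f'

/-- With `G = crossGram f f'`, expanding `f j` by the hypothesis gives `Gᴴ G = Gᴴ`. The left side is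
self-adjoint, hence so is `G`, which is then idempotent. -/
theorem isProjMatrix_kernelMatrix {f f' : Fin n → E} (h : ∀ i, pairOp f f (f' i) = f i) :
    IsProjMatrix (kernelMatrix f f') := by
  have h1 : (crossGram f f')ᴴ * crossGram f f' = (crossGram f f')ᴴ := by
    ext i j
    rw [mul_apply, conjTranspose_apply, crossGram_apply, RCLike.star_def, inner_conj_symm,
      ← h j, pairOp_apply, inner_sum]
    refine Finset.sum_congr rfl fun m _ => ?_
    rw [conjTranspose_apply, crossGram_apply, crossGram_apply, RCLike.star_def, inner_conj_symm,
      inner_smul_right, mul_comm]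
  have h2 : (crossGram f f')ᴴ = crossGram f f' := by
    have := congrArg conjTranspose h1
    rw [conjTranspose_mul, conjTranspose_conjTranspose, h1] at this
    exact this
  rw [h2] at h1
  refine ⟨?_, ?_⟩
  · rw [kernelMatrix, conjTranspose_sub, h2, conjTranspose_one]
  · rw [kernelMatrix, sub_mul, one_mul, mul_sub, mul_one, h1, sub_self, sub_zero]

theorem kernelMatrix_mulVec_analysisMap {f f' : Fin n → E} (h : ∀ i, pairOp f f (f' i) = f i)
    (ξ : E) : kernelMatrix f f' *ᵥ analysisMap f ξ = 0 := by
  have h2 := (isProjMatrix_kernelMatrix h).1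
  rw [kernelMatrix, conjTranspose_sub, conjTranspose_one, sub_right_inj] at h2
  rw [kernelMatrix, sub_mulVec, one_mulVec, sub_eq_zero, ← h2]
  ext i
  rw [analysisMap_apply, ← h i, inner_pairOp_left, pairOp_apply, inner_sum]
  simp only [mulVec, dotProduct, conjTranspose_apply, crossGram_apply, RCLike.star_def,
    inner_conj_symm, inner_smul_right, analysisMap_apply]
  exact Finset.sum_congr rfl fun j _ => mul_comm _ _

/-- Against `f`, each `f' j` has the same coefficients as its image under `pairOp φ f`, which lies
in the span of `φ`. So `crossGram f f'` has rank at most the dimension of that span, and its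
complement has at least the remaining rank. -/
theorem le_rank_kernelMatrix {φ f f' : Fin n → E} (h : ∀ i, pairOp f φ (f i) = f i) :
    n - Module.finrank ℂ (Submodule.span ℂ (Set.range φ)) ≤ (kernelMatrix f f').rank := by
  have : FiniteDimensional ℂ (Submodule.span ℂ (Set.range φ)) :=
    FiniteDimensional.span_of_finite ℂ (Set.finite_range φ)
  have h1 : (crossGram f f').rank ≤ Module.finrank ℂ (Submodule.span ℂ (Set.range φ)) := by
    refine rank_crossGram_le fun j => ⟨pairOp φ f (f' j), pairOp_apply_mem _ _ _, ?_⟩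
    ext i
    rw [analysisMap_apply, analysisMap_apply, ← inner_pairOp_left, h]
  have h2 := matrix_rank_add_le (kernelMatrix f f') (crossGram f f')
  rw [kernelMatrix, sub_add_cancel, rank_one, Fintype.card_fin] at h2
  rw [kernelMatrix]
  omega

/-- The family with coefficient matrix `M` with respect to `φ`. -/
def combine (M : Matrix (Fin n) (Fin n) ℂ) (φ : Fin n → E) : Fin n → E :=
  fun j => ∑ i, M i j • φ i

theorem pairOp_combine (M : Matrix (Fin n) (Fin n) ℂ) (φ v : Fin n → E) (ξ : E) :
    pairOp (combine M φ) v ξ = Fintype.linearCombination ℂ φ (M *ᵥ analysisMap v ξ) := by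
  rw [pairOp_eq, Fintype.linearCombination_apply, Fintype.linearCombination_apply]
  simp only [combine, mulVec, dotProduct, Finset.smul_sum, Finset.sum_smul, smul_smul]
  rw [Finset.sum_comm]
  exact Finset.sum_congr rfl fun i _ => Finset.sum_congr rfl fun j _ => by rw [mul_comm]

theorem analysisMap_combine (M : Matrix (Fin n) (Fin n) ℂ) (φ : Fin n → E) (ξ : E) :
    analysisMap (combine M φ) ξ = Mᴴ *ᵥ analysisMap φ ξ := by
  ext j
  simp only [analysisMap_apply, combine, sum_inner, inner_smul_left, mulVec, dotProduct,
    conjTranspose_apply, RCLike.star_def]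

/-- Factoring `A` through `combine`, with values in the kernel of the synthesis of `f`. -/
theorem pairOp_combine_factor {φ θ f f' : Fin n → E} {c : ℂ} {A : E →L[ℂ] E}
    (hA : A = c • pairOp φ θ - pairOp φ φ) (hpos : A.IsPositive)
    (hφ : ∀ i, pairOp φ θ (φ i) = φ i)
    (hf : ∀ i, pairOp f φ (f i) = f i) (hf' : ∀ i, pairOp f f (f' i) = f i)
    (hrank : Module.finrank ℂ (LinearMap.range A.toLinearMap) ≤
      n - Module.finrank ℂ (Submodule.span ℂ (Set.range φ))) :
    pairOp (combine (factor n (crossGram θ fun j => A (θ j)) (kernelMatrix f f')) φ)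
      (combine (factor n (crossGram θ fun j => A (θ j)) (kernelMatrix f f')) φ) = A ∧
    pairOp (combine (factor n (crossGram θ fun j => A (θ j)) (kernelMatrix f f')) φ) f = 0 := by
  have hfinφ : FiniteDimensional ℂ (Submodule.span ℂ (Set.range φ)) :=
    FiniteDimensional.span_of_finite ℂ (Set.finite_range φ)
  have hmem : ∀ ξ, A ξ ∈ Submodule.span ℂ (Set.range φ) := fun ξ => by
    rw [hA]
    exact Submodule.sub_mem _ (Submodule.smul_mem _ _ (pairOp_apply_mem _ _ _))
      (pairOp_apply_mem _ _ _)
  have hfinA : FiniteDimensional ℂ (LinearMap.range A.toLinearMap) := by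
    refine Submodule.finiteDimensional_of_le (S₂ := Submodule.span ℂ (Set.range φ)) ?_
    rintro _ ⟨ξ, rfl⟩
    exact hmem ξ
  have hN : (crossGram θ fun j => A (θ j)).rank ≤ (kernelMatrix f f').rank := by
    refine le_trans ?_ (hrank.trans (le_rank_kernelMatrix hf))
    exact rank_crossGram_le fun j => ⟨A (θ j), LinearMap.mem_range_self _ _, rfl⟩
  obtain ⟨h1, h2⟩ := factor_spec n (posSemidef_crossGram hpos θ) (isProjMatrix_kernelMatrix hf') hN
    (rank_le_width _)
  generalize factor n (crossGram θ fun j => A (θ j)) (kernelMatrix f f') = M at h1 h2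
  constructor
  · ext ξ
    have hPA : ∀ ξ, pairOp φ θ (A ξ) = A ξ := fun ξ => apply_eq_self_of_mem_span hφ (hmem ξ)
    -- `A` maps into the span of `φ` and is symmetric, so `A = P A P*` with `P = pairOp φ θ`.
    -- Written out, this expresses `A` in terms of `φ` with coefficient matrix `⟨θ i, A θ j⟩`.
    have hAP : A (pairOp θ φ ξ) = A ξ := by
      refine ext_inner_left ℂ fun η => ?_
      have hs : ∀ a b, inner ℂ a (A b) = inner ℂ (A a) b := fun a b => (hpos.isSymmetric a b).symm
      rw [hs, ← inner_pairOp_left, hPA, ← hs]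
    rw [pairOp_combine, analysisMap_combine, mulVec_mulVec, h1, crossGram_mulVec]
    have : Fintype.linearCombination ℂ (fun j => A (θ j)) (analysisMap φ ξ) =
        A (pairOp θ φ ξ) := by
      rw [pairOp_eq, Fintype.linearCombination_apply, Fintype.linearCombination_apply, map_sum]
      simp only [map_smul]
    rw [this, ← pairOp_eq, hPA, hAP]
  · ext ξ
    rw [pairOp_combine, ← h2, ← mulVec_mulVec, kernelMatrix_mulVec_analysisMap hf', mulVec_zero,
      map_zero, _root_.zero_apply]

end FiniteFamilyRanks

/-! ### Shift-invariant subspaces and operators commuting with translations. -/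

section Translations

open ContinuousLinearMap

variable {k n : ℕ}

theorem character_add (l m : Fin k → ℤ) (x : Rk k) :
    character (l + m) x = character l x * character m x := by
  have : latticeVec (l + m) = latticeVec l + latticeVec m := by ext i; simp [latticeVec]
  rw [character, this, inner_add_left, neg_add, AddChar.map_add_eq_mul, Circle.coe_mul]
  rfl

theorem character_zero (x : Rk k) : character 0 x = 1 := by
  have : latticeVec (0 : Fin k → ℤ) = 0 := by ext i; simp [latticeVec]
  rw [character, this]
  simp

theorem translate_translate (l m : Fin k → ℤ) (f : L2 k) :
    translate l (translate m f) = translate (l + m) f := by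
  refine eq_of_fiber_ae_eq ?_
  filter_upwards [fiber_translate l (translate m f), fiber_translate m f,
    fiber_translate (l + m) f] with x h1 h2 h3
  rw [h1, h2, h3, smul_smul, character_add]

theorem translate_zero (f : L2 k) : translate 0 f = f := by
  refine eq_of_fiber_ae_eq ?_
  filter_upwards [fiber_translate 0 f] with x h1
  rw [h1, character_zero, one_smul]

theorem translate_sub (l : Fin k → ℤ) (f g : L2 k) :
    translate l (f - g) = translate l f - translate l g := map_sub (translateL l) f g

theorem translates_sub (F G : Fin n → L2 k) :
    translates (fun i => F i - G i) = fun p => translates F p - translates G p :=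
  funext fun p => translate_sub p.1 _ _

theorem inner_translate_left (l : Fin k → ℤ) (f g : L2 k) :
    inner ℂ (translate l f) g = inner ℂ f (translate (-l) g) := by
  have h := (translateL l).inner_map_map f (translate (-l) g)
  rw [translateL_apply, translateL_apply, translate_translate, add_neg_cancel,
    translate_zero] at h
  exact h

/-- A subspace that contains all integer translates of its elements. -/
def IsShiftInvariant (V : ClosedSubmodule ℂ (L2 k)) : Prop :=
  ∀ l : Fin k → ℤ, ∀ f ∈ V, translate l f ∈ V

theorem IsFSI.isShiftInvariant {V : ClosedSubmodule ℂ (L2 k)} (hV : IsFSI V) :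
    IsShiftInvariant V := by
  obtain ⟨A, -, rfl⟩ := hV
  intro l
  suffices h : shiftSpan A ≤ (shiftSpan A).comap (translateL l).toContinuousLinearMap from
    fun f hf => h hf
  refine Submodule.closure_le.2 (Submodule.span_le.2 ?_)
  rintro _ ⟨f, hf, m, rfl⟩
  change translate l (translate m f) ∈ shiftSpan A
  rw [translate_translate]
  exact Submodule.mem_closure_iff.2
    (Submodule.le_topologicalClosure _ (Submodule.subset_span ⟨f, hf, _, rfl⟩))

theorem IsShiftInvariant.translate_mem_orthogonal {W : ClosedSubmodule ℂ (L2 k)}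
    (hW : IsShiftInvariant W) (l : Fin k → ℤ) {f : L2 k} (hf : f ∈ W.toSubmoduleᗮ) :
    translate l f ∈ W.toSubmoduleᗮ := by
  rw [Submodule.mem_orthogonal'] at hf ⊢
  intro u hu
  rw [inner_translate_left]
  exact hf _ (hW (-l) u hu)

/-- An operator commuting with the integer translations. -/
def IsShiftPreserving (S : L2 k →L[ℂ] L2 k) : Prop :=
  ∀ (l : Fin k → ℤ) (f : L2 k), S (translate l f) = translate l (S f)

theorem IsFiberField.isShiftPreserving {S : L2 k →L[ℂ] L2 k}
    {s : Rk k → FiberSpace k →L[ℂ] FiberSpace k} (hs : IsFiberField S s) :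
    IsShiftPreserving S := fun l f => by
  refine eq_of_fiber_ae_eq ?_
  filter_upwards [hs.2.2 (translate l f), hs.2.2 f, fiber_translate l f,
    fiber_translate l (S f)] with x h1 h2 h3 h4
  rw [← h1, h3, map_smul, h2, h4]

theorem IsShiftInvariant.orthProj {W : ClosedSubmodule ℂ (L2 k)} (hW : IsShiftInvariant W) :
    IsShiftPreserving (orthProj W) := fun l f => by
  refine Submodule.eq_starProjection_of_mem_orthogonal (hW l _ (orthProj_mem W f)) ?_
  rw [← translate_sub]
  exact hW.translate_mem_orthogonal l (Submodule.sub_starProjection_mem_orthogonal f)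

theorem IsShiftPreserving.translates_map {S : L2 k →L[ℂ] L2 k} (hS : IsShiftPreserving S)
    (F : Fin n → L2 k) : translates (fun i => S (F i)) = fun p => S (translates F p) :=
  funext fun p => (hS p.1 (F p.2)).symm

theorem isShiftPreserving_pseudoInverse {W : ClosedSubmodule ℂ (L2 k)} {F : Fin n → L2 k}
    (hW : IsShiftInvariant W) (hF : IsFrameFor W (translates F)) :
    IsShiftPreserving (pseudoInverse (frameOperator (translates F))) := by
  obtain ⟨h1, h2, h3⟩ := hF.pseudoInverse_spec
  have hS : IsShiftPreserving (frameOperator (translates F)) :=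
    (isFiberField_mixedOperator hF.isBessel hF.isBessel).isShiftPreserving
  have hP := hW.orthProj
  set S := frameOperator (translates F)
  set B := pseudoInverse S
  set P := ObliqueDuals.orthProj W
  have hBP : B ∘L P = B := by rw [← h1, ← comp_assoc, h2, h3]
  intro l f
  have e1 := fun g => DFunLike.congr_fun h1 g
  have e2 := fun g => DFunLike.congr_fun h2 g
  have e3 := fun g => DFunLike.congr_fun h3 g
  have e4 := fun g => DFunLike.congr_fun hBP g
  simp only [comp_apply] at e1 e2 e3 e4
  rw [← e4, hP, ← e1, ← hS, e2, hP, e3]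

end Translations

/-! ### The range function as the span of the fibers of the generators. -/

section RangeFunctions

open ContinuousLinearMap

variable {k n : ℕ}

theorem ae_pairOp_fiber {G H : Fin n → L2 k} (hG : IsBessel (translates G))
    (hH : IsBessel (translates H)) {f g : L2 k} (h : mixedOperator G H f = g) :
    ∀ᵐ x ∂torusMeasure k, pairOp (fibers G x) (fibers H x) (fiber f x) = fiber g x := by
  rw [← h]
  exact (isFiberField_mixedOperator hG hH).2.2 f

/-- The span of the fibers of finitely many generators. -/
def fiberSpan (φ : Fin n → L2 k) (x : Rk k) : ClosedSubmodule ℂ (FiberSpace k) where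
  toSubmodule := Submodule.span ℂ (Set.range (fibers φ x))
  isClosed' := by
    have : FiniteDimensional ℂ (Submodule.span ℂ (Set.range (fibers φ x))) :=
      FiniteDimensional.span_of_finite ℂ (Set.finite_range _)
    exact Submodule.closed_of_finiteDimensional _

variable {V : ClosedSubmodule ℂ (L2 k)} {φ θ : Fin n → L2 k}

theorem ae_pairOp_swap (hφ : IsBessel (translates φ)) (hθ : IsBessel (translates θ))
    (hP : mixedOperator φ θ = orthProj V) :
    ∀ᵐ x ∂torusMeasure k,
      pairOp (fibers φ x) (fibers θ x) = pairOp (fibers θ x) (fibers φ x) := by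
  have h2 : mixedOperator θ φ = orthProj V := by
    rw [← adjoint_mixedOperator, hP, adjoint_orthProj]
  have f1 := isFiberField_mixedOperator hφ hθ
  have f2 := isFiberField_mixedOperator hθ hφ
  rw [hP] at f1
  rw [h2] at f2
  exact f1.ae_eq f2

theorem ae_pairOp_generator (hφ : IsBessel (translates φ)) (hθ : IsBessel (translates θ))
    (hP : mixedOperator φ θ = orthProj V) (hφV : ∀ i, φ i ∈ V) :
    ∀ᵐ x ∂torusMeasure k, ∀ i, pairOp (fibers φ x) (fibers θ x) (fibers φ x i) = fibers φ x i := by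
  rw [ae_all_iff]
  exact fun i => ae_pairOp_fiber hφ hθ (by rw [hP, orthProj_eq_self_iff.2 (hφV i)])

/-- Self-adjointness of `P_V` passes to the fibers, and the fiber operator fixes the span of the `φ
i(x)` and maps into it. -/
theorem ae_orthProj_fiberSpan (hφ : IsBessel (translates φ)) (hθ : IsBessel (translates θ))
    (hP : mixedOperator φ θ = orthProj V) (hφV : ∀ i, φ i ∈ V) :
    ∀ᵐ x ∂torusMeasure k, orthProj (fiberSpan φ x) = pairOp (fibers φ x) (fibers θ x) := by
  filter_upwards [ae_pairOp_swap hφ hθ hP, ae_pairOp_generator hφ hθ hP hφV] with x h1 h2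
  ext1 ξ
  refine Submodule.eq_starProjection_of_mem_of_inner_eq_zero (pairOp_apply_mem _ _ ξ)
    fun w hw => ?_
  rw [inner_sub_left, inner_pairOp_left, ← h1, apply_eq_self_of_mem_span h2 hw, sub_self]

theorem mem_iff_ae_fiber_mem_fiberSpan (hφ : IsBessel (translates φ))
    (hθ : IsBessel (translates θ)) (hP : mixedOperator φ θ = orthProj V) (hφV : ∀ i, φ i ∈ V)
    (f : L2 k) : f ∈ V ↔ ∀ᵐ x ∂torusMeasure k, fiber f x ∈ fiberSpan φ x := by
  constructor
  · intro hf
    filter_upwards [ae_pairOp_fiber hφ hθ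
      (show mixedOperator φ θ f = f by rw [hP, orthProj_eq_self_iff.2 hf])] with x hx
    rw [← hx]
    exact pairOp_apply_mem _ _ _
  · intro hf
    rw [← orthProj_eq_self_iff, ← hP]
    refine eq_of_fiber_ae_eq ?_
    filter_upwards [hf, ae_pairOp_fiber hφ hθ (rfl : mixedOperator φ θ f = _),
      ae_pairOp_generator hφ hθ hP hφV] with x h1 h2 h3
    rw [← h2]
    exact apply_eq_self_of_mem_span h3 h1

theorem isRangeFunction_fiberSpan (hφ : IsBessel (translates φ)) (hθ : IsBessel (translates θ))
    (hP : mixedOperator φ θ = orthProj V) (hφV : ∀ i, φ i ∈ V) :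
    IsRangeFunction V (fiberSpan φ) := by
  refine ⟨fun ξ η => ?_, mem_iff_ae_fiber_mem_fiberSpan hφ hθ hP hφV⟩
  refine ((isFiberField_mixedOperator hφ hθ).1 ξ η).congr ?_
  filter_upwards [ae_orthProj_fiberSpan hφ hθ hP hφV] with x hx
  rw [hx]

/-- By weak measurability, the projections of each coordinate vector to the `J x` are the fibers of
an element of `V`, hence lie in the span. These projections generate `J x`, which gives one
inclusion; the other holds because the generators are in `V`. -/
theorem IsRangeFunction.ae_eq_fiberSpan (hφ : IsBessel (translates φ))
    (hθ : IsBessel (translates θ)) (hP : mixedOperator φ θ = orthProj V) (hφV : ∀ i, φ i ∈ V)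
    {J : Rk k → ClosedSubmodule ℂ (FiberSpace k)} (hJ : IsRangeFunction V J) :
    ∀ᵐ x ∂torusMeasure k, J x = fiberSpan φ x := by
  have hmeas : ∀ l : Fin k → ℤ, MemLp (fun x => orthProj (J x) (unitVec l)) 2
      (torusMeasure k) := fun l => by
    refine MemLp.of_bound (aestronglyMeasurable_ell2 fun m => ?_) ‖(unitVec l : FiberSpace k)‖
      (Filter.Eventually.of_forall fun x => Submodule.norm_starProjection_apply_le _ _)
    have := (hJ.1 (unitVec l) (unitVec m)).aestronglyMeasurable
    simpa only [inner_unitVec_left] using this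
  choose h hh using fun l => exists_fiber_eq (hmeas l)
  have hV : ∀ l, h l ∈ V := fun l => by
    rw [hJ.2]
    filter_upwards [hh l] with x hx
    rw [hx]
    exact orthProj_mem _ _
  have hspan : ∀ᵐ x ∂torusMeasure k, ∀ l, fiber (h l) x ∈ fiberSpan φ x :=
    ae_all_iff.2 fun l => (mem_iff_ae_fiber_mem_fiberSpan hφ hθ hP hφV (h l)).1 (hV l)
  have hgen : ∀ᵐ x ∂torusMeasure k, ∀ i, fiber (φ i) x ∈ J x :=
    ae_all_iff.2 fun i => (hJ.2 (φ i)).1 (hφV i)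
  filter_upwards [hspan, hgen, ae_all_iff.2 hh] with x h1 h2 h3
  refine le_antisymm (fun ξ hξ => ?_) ?_
  · have e1 : orthProj (fiberSpan φ x) ∘L orthProj (J x) = orthProj (J x) := by
      refine clm_ext_unitVec fun l => ?_
      rw [comp_apply, orthProj_eq_self_iff, ← h3 l]
      exact h1 l
    have e2 := DFunLike.congr_fun e1 ξ
    rw [comp_apply, orthProj_eq_self_iff.2 hξ] at e2
    exact orthProj_eq_self_iff.1 e2
  · have : Submodule.span ℂ (Set.range (fibers φ x)) ≤ (J x).toSubmodule :=
      Submodule.span_le.2 (by rintro _ ⟨i, rfl⟩; exact h2 i)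
    exact fun ξ hξ => this hξ

theorem ae_rangeFunction_eq (hφ : IsBessel (translates φ)) (hθ : IsBessel (translates θ))
    (hP : mixedOperator φ θ = orthProj V) (hφV : ∀ i, φ i ∈ V) :
    ∀ᵐ x ∂torusMeasure k, rangeFunction V x = fiberSpan φ x := by
  have h : ∃ J, IsRangeFunction V J := ⟨_, isRangeFunction_fiberSpan hφ hθ hP hφV⟩
  rw [rangeFunction, dif_pos h]
  exact h.choose_spec.ae_eq_fiberSpan hφ hθ hP hφV

end RangeFunctions

/-! ### Tight duals as perturbations of the canonical oblique dual. -/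

section TightDuals

open ContinuousLinearMap

variable {k n : ℕ}

/-- Families `φ` (the generators of the canonical oblique dual of `F`), `θ` and `F'` (auxiliary
duals), with the oblique projection `Q` onto `V` along `Wᗮ`. -/
structure IsCanonicalSystem (V W : ClosedSubmodule ℂ (L2 k)) (Q : L2 k →L[ℂ] L2 k)
    (F φ θ F' : Fin n → L2 k) : Prop where
  shiftInvariant : IsShiftInvariant V
  projection_of_mem : ∀ h ∈ V, Q h = h
  projection_of_mem_orthogonal : ∀ h ∈ W.toSubmoduleᗮ, Q h = 0
  sub_projection_mem : ∀ h, h - Q h ∈ W.toSubmoduleᗮ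
  mem_left : ∀ p, translates F p ∈ W
  mem_right : ∀ i, φ i ∈ V
  bessel_left : IsBessel (translates F)
  bessel_right : IsBessel (translates φ)
  bessel_aux : IsBessel (translates θ)
  mixed_projection : mixedOperator φ F = Q
  mixed_orthProj : mixedOperator φ θ = orthProj V
  mixed_dual : ∀ i, mixedOperator F F (F' i) = F i
  exists_map : ∃ L : L2 k →L[ℂ] L2 k, synthesis (translates φ) = L ∘L synthesis (translates F)

namespace IsCanonicalSystem

variable {V W : ClosedSubmodule ℂ (L2 k)} {Q : L2 k →L[ℂ] L2 k} {F φ θ F' : Fin n → L2 k}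

theorem adjoint_projection_of_mem (hS : IsCanonicalSystem V W Q F φ θ F') {h : L2 k}
    (hh : h ∈ W) : adjoint Q h = h := by
  refine ext_inner_right ℂ fun g => ?_
  rw [adjoint_inner_left]
  have h0 : inner ℂ h (g - Q g) = 0 :=
    (Submodule.mem_orthogonal _ _).1 (hS.sub_projection_mem g) h hh
  rw [inner_sub_right, sub_eq_zero] at h0
  exact h0.symm

theorem mem_left_generator (hS : IsCanonicalSystem V W Q F φ θ F') (i : Fin n) : F i ∈ W := by
  have := hS.mem_left (0, i)
  rwa [translates, translate_zero] at this

theorem ae_relations (hS : IsCanonicalSystem V W Q F φ θ F') :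
    ∀ᵐ x ∂torusMeasure k,
      (∀ i, pairOp (fibers φ x) (fibers F x) (fibers φ x i) = fibers φ x i) ∧
      (∀ i, pairOp (fibers φ x) (fibers θ x) (fibers φ x i) = fibers φ x i) ∧
      (∀ i, pairOp (fibers F x) (fibers φ x) (fibers F x i) = fibers F x i) ∧
      (∀ i, pairOp (fibers F x) (fibers F x) (fibers F' x i) = fibers F x i) := by
  have h1 : ∀ i, mixedOperator φ F (φ i) = φ i := fun i => by
    rw [hS.mixed_projection, hS.projection_of_mem _ (hS.mem_right i)]
  have h2 : ∀ i, mixedOperator F φ (F i) = F i := fun i => by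
    rw [← adjoint_mixedOperator, hS.mixed_projection,
      hS.adjoint_projection_of_mem (hS.mem_left_generator i)]
  filter_upwards [
    ae_all_iff.2 fun i => ae_pairOp_fiber hS.bessel_right hS.bessel_left (h1 i),
    ae_pairOp_generator hS.bessel_right hS.bessel_aux hS.mixed_orthProj hS.mem_right,
    ae_all_iff.2 fun i => ae_pairOp_fiber hS.bessel_left hS.bessel_right (h2 i),
    ae_all_iff.2 fun i => ae_pairOp_fiber hS.bessel_left hS.bessel_left (hS.mixed_dual i)]
    with x a1 a2 a3 a4
  exact ⟨a1, a2, a3, a4⟩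

theorem ae_rangeFunction (hS : IsCanonicalSystem V W Q F φ θ F') :
    ∀ᵐ x ∂torusMeasure k, rangeFunction V x = fiberSpan φ x :=
  ae_rangeFunction_eq hS.bessel_right hS.bessel_aux hS.mixed_orthProj hS.mem_right

theorem isFiberField_defect (hS : IsCanonicalSystem V W Q F φ θ F') (c : ℂ) :
    IsFiberField (c • orthProj V - frameOperator (translates φ)) fun x =>
      c • pairOp (fibers φ x) (fibers θ x) - pairOp (fibers φ x) (fibers φ x) := by
  rw [← hS.mixed_orthProj, ← mixedOperator_self]
  exact ((isFiberField_mixedOperator hS.bessel_right hS.bessel_aux).smul c).sub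
    (isFiberField_mixedOperator hS.bessel_right hS.bessel_right)

/-- The difference of a frame operator and that of the canonical oblique dual. -/
theorem frameOperator_sub (hS : IsCanonicalSystem V W Q F φ θ F') {r : Fin n → L2 k}
    (hr : IsBessel (translates r)) (hrF : mixedOperator r F = 0) :
    IsBessel (translates fun i => φ i - r i) ∧
    frameOperator (translates fun i => φ i - r i) =
      frameOperator (translates φ) + frameOperator (translates r) := by
  obtain ⟨L, hL⟩ := hS.exists_map
  -- `T_φ = L T_F` gives `T_r T_φ* = (T_r T_F*) L* = 0`; this is where the canonical dual is
  -- special.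
  have hrφ : synthesis (translates r) ∘L adjoint (synthesis (translates φ)) = 0 := by
    rw [hL, adjoint_comp, ← comp_assoc]
    change mixedOperator r F ∘L _ = 0
    rw [hrF, zero_comp]
  have hφr : synthesis (translates φ) ∘L adjoint (synthesis (translates r)) = 0 := by
    have := congrArg adjoint hrφ
    rwa [adjoint_comp, adjoint_adjoint, map_zero] at this
  rw [translates_sub]
  refine ⟨hS.bessel_right.sub hr, ?_⟩
  rw [frameOperator, hS.bessel_right.synthesis_sub hr, map_sub, sub_comp, comp_sub, comp_sub,
    hrφ, hφr, frameOperator, frameOperator]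
  abel

/-- Duality says `T_F T_G*` is the identity on `W`, so `h - T_G T_F* h` is orthogonal to `W` and is
killed by `Q`; and `T_G T_F* h` lies in `V`, where `Q` is the identity. -/
theorem mixedOperator_eq_of_isObliqueDual (hS : IsCanonicalSystem V W Q F φ θ F')
    {G : Fin n → L2 k} (hG : IsSGDual V W F G) : mixedOperator G F = Q := by
  obtain ⟨hGV, hGV', hGB, hGd⟩ := hG
  have h1 : ∀ h ∈ W, mixedOperator F G h = h := fun h hh => by
    have := hS.bessel_left.hasSum_synthesis (adjoint (synthesis (translates G)) h)
    simp only [hGB.adjoint_synthesis_apply] at this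
    exact this.unique (hGd h hh)
  have hV : ∀ h, mixedOperator G F h ∈ V := fun h => by
    rw [← orthProj_eq_self_iff, mixedOperator, ← comp_apply, ← comp_assoc,
      orthProj_comp_synthesis hGB hGV']
  ext1 h
  rw [← hS.projection_of_mem _ (hV h), ← sub_eq_zero, ← map_sub]
  refine hS.projection_of_mem_orthogonal _ ((Submodule.mem_orthogonal _ _).2 fun w hw => ?_)
  rw [inner_sub_right, ← adjoint_inner_left, adjoint_mixedOperator, h1 w hw, sub_self]

/-- Necessity: with `r = φ - G` the defect equals `T_r T_r*`, hence is positive, and its fibers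
satisfy the finite-dimensional rank bound. -/
theorem isPositive_and_rank_of_isTight (hS : IsCanonicalSystem V W Q F φ θ F') {c : ℝ}
    {G : Fin n → L2 k} (hG : IsSGDual V W F G) (hT : IsTight V c G) :
    frameOperator (translates φ) ≤ (c : ℂ) • orthProj V ∧
      ∀ᵐ x ∂torusMeasure k, x ∈ spec V →
        LinearMap.rank (fiberOperator ((c : ℂ) • orthProj V - frameOperator (translates φ))
          x).toLinearMap ≤ ((min (fiberDim V x) (n - fiberDim V x) : ℕ) : Cardinal) := by
  have hGF := hS.mixedOperator_eq_of_isObliqueDual hG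
  obtain ⟨hGV, hGV', hGB, hGd⟩ := hG
  let r : Fin n → L2 k := fun i => φ i - G i
  have hr : IsBessel (translates r) := by
    rw [translates_sub]; exact hS.bessel_right.sub hGB
  have hrF : mixedOperator r F = 0 := by
    rw [mixedOperator, translates_sub, hS.bessel_right.synthesis_sub hGB, sub_comp]
    change mixedOperator φ F - mixedOperator G F = 0
    rw [hS.mixed_projection, hGF, sub_self]
  have hGr : (fun i => φ i - r i) = G := funext fun i => sub_sub_cancel _ _
  have hA : (c : ℂ) • orthProj V - frameOperator (translates φ) = mixedOperator r r := by
    have := (hS.frameOperator_sub hr hrF).2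
    rw [hGr, hT] at this
    rw [this, add_sub_cancel_left, mixedOperator_self]
  refine ⟨?_, ?_⟩
  · rw [le_def, hA]
    exact isPositive_self_comp_adjoint _
  have hrV : ∀ i, r i ∈ V := fun i => V.toSubmodule.sub_mem (hS.mem_right i) (hGV i)
  have hfield := isFiberField_fiberOperator (isFiberField_mixedOperator hr hr)
  have hrF' := (isFiberField_mixedOperator hr hS.bessel_left)
  rw [hrF] at hrF'
  rw [hA]
  have hmem : ∀ᵐ x ∂torusMeasure k, ∀ i, fiber (r i) x ∈ fiberSpan φ x := ae_all_iff.2 fun i =>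
    (mem_iff_ae_fiber_mem_fiberSpan hS.bessel_right hS.bessel_aux hS.mixed_orthProj
      hS.mem_right (r i)).1 (hrV i)
  filter_upwards [hfield, hS.ae_rangeFunction, hS.ae_relations, hmem,
    hrF'.ae_eq IsFiberField.zero] with x h1 h2 h3 h4 h5 _
  rw [h1, fiberDim, h2]
  exact rank_pairOp_self_le h3.1 (fun ξ => by rw [h5]; rfl) h4

/-- The term `i = j` alone in `⟨u j, S (u j)⟩ = ∑ |⟨u i, u j⟩|²`, with `S = pairOp u u`, is `‖u
j‖⁴`. -/
theorem norm_sq_le_norm_pairOp {E : Type*} [NormedAddCommGroup E] [InnerProductSpace ℂ E]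
    (u : Fin n → E) (j : Fin n) : ‖u j‖ ^ 2 ≤ ‖pairOp u u‖ := by
  have h1 : inner ℂ (u j) (pairOp u u (u j)) = ((∑ i, ‖inner ℂ (u i) (u j)‖ ^ 2 : ℝ) : ℂ) := by
    rw [pairOp_apply, inner_sum]
    push_cast
    refine Finset.sum_congr rfl fun i _ => ?_
    rw [inner_smul_right, ← inner_conj_symm (u j) (u i), Complex.mul_conj']
  have h2 : ‖inner ℂ (u j) (u j)‖ ^ 2 ≤ ∑ i, ‖inner ℂ (u i) (u j)‖ ^ 2 :=
    Finset.single_le_sum (f := fun i => ‖inner ℂ (u i) (u j)‖ ^ 2) (fun i _ => sq_nonneg _)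
      (Finset.mem_univ j)
  have h3 : ∑ i, ‖inner ℂ (u i) (u j)‖ ^ 2 ≤ ‖u j‖ * (‖pairOp u u‖ * ‖u j‖) := by
    calc _ = ‖inner ℂ (u j) (pairOp u u (u j))‖ := by
          rw [h1, Complex.norm_real, Real.norm_of_nonneg (by positivity)]
      _ ≤ _ := (norm_inner_le_norm _ _).trans (by gcongr; exact le_opNorm _ _)
  rw [inner_self_eq_norm_sq_to_K, norm_pow, RCLike.norm_ofReal, abs_norm] at h2
  rcases eq_or_lt_of_le (norm_nonneg (u j)) with h0 | h0
  · rw [← h0]; simp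
  · have h4 : ‖u j‖ ^ 2 * ‖u j‖ ^ 2 ≤ ‖pairOp u u‖ * ‖u j‖ ^ 2 := by nlinarith
    exact le_of_mul_le_mul_right h4 (by positivity)

/-- Sufficiency: the defect is factored fiber by fiber, the factors are assembled into functions
`r`, and `φ - r` is the required dual. -/
theorem exists_isTight_of_rank (hS : IsCanonicalSystem V W Q F φ θ F') {c : ℝ}
    (hle : frameOperator (translates φ) ≤ (c : ℂ) • orthProj V)
    (hrank : ∀ᵐ x ∂torusMeasure k, x ∈ spec V →
        LinearMap.rank (fiberOperator ((c : ℂ) • orthProj V - frameOperator (translates φ))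
          x).toLinearMap ≤ ((min (fiberDim V x) (n - fiberDim V x) : ℕ) : Cardinal)) :
    ∃ G : Fin n → L2 k, IsSGDual V W F G ∧ IsTight V c G := by
  have hA := hS.isFiberField_defect (c : ℂ)
  rw [le_def] at hle
  set A := (c : ℂ) • orthProj V - frameOperator (translates φ) with hAdef
  set a : Rk k → FiberSpace k →L[ℂ] FiberSpace k := fun x =>
    (c : ℂ) • pairOp (fibers φ x) (fibers θ x) - pairOp (fibers φ x) (fibers φ x) with ha
  let M : Rk k → Matrix (Fin n) (Fin n) ℂ := fun x =>
    factor n (crossGram (fibers θ x) fun j => a x (fibers θ x j))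
      (kernelMatrix (fibers F x) (fibers F' x))
  have hMmeas : ∀ i j, AEMeasurable (fun x => M x i j) (torusMeasure k) := by
    refine aemeasurable_factor n (fun i j => ?_) (fun i j => ?_)
    · simp only [crossGram_apply]
      have h1 : AEStronglyMeasurable (fun x => a x (fibers θ x j)) (torusMeasure k) :=
        ((aestronglyMeasurable_pairOp φ θ (aestronglyMeasurable_fiber (θ j))).const_smul
          (c : ℂ)).sub (aestronglyMeasurable_pairOp φ φ (aestronglyMeasurable_fiber (θ j)))
      exact ((aestronglyMeasurable_fiber (θ i)).inner h1).aemeasurable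
    · simp only [kernelMatrix, Matrix.sub_apply, crossGram_apply]
      exact aemeasurable_const.sub (aestronglyMeasurable_inner_fiber (F i) (F' j)).aemeasurable
  have hkey : ∀ᵐ x ∂torusMeasure k,
      pairOp (combine (M x) (fibers φ x)) (combine (M x) (fibers φ x)) = a x ∧
      pairOp (combine (M x) (fibers φ x)) (fibers F x) = 0 := by
    filter_upwards [hS.ae_relations, hA.isPositive hle, hrank, hS.ae_rangeFunction,
      isFiberField_fiberOperator hA, ae_mem_torus k] with x h1 h2 h3 h4 h5 h6
    refine pairOp_combine_factor rfl h2 h1.2.1 h1.2.2.1 h1.2.2.2 ?_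
    by_cases hx : x ∈ spec V
    · have h7 := h3 hx
      rw [h5, fiberDim, h4] at h7
      exact (Module.finrank_le_of_rank_le h7).trans (min_le_right _ _)
    -- Off the spectrum the rank hypothesis is silent, but there the fiber of the defect is zero.
    · have h7 : rangeFunction V x = ⊥ := by
        by_contra h8
        exact hx ⟨h6, h8⟩
      have h8 : LinearMap.range (a x).toLinearMap ≤ ⊥ := by
        rintro _ ⟨ξ, rfl⟩
        have h9 : a x ξ ∈ fiberSpan φ x :=
          (fiberSpan φ x).toSubmodule.sub_mem
            ((fiberSpan φ x).toSubmodule.smul_mem _ (pairOp_apply_mem _ _ _))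
            (pairOp_apply_mem _ _ _)
        rw [← h4, h7] at h9
        exact h9
      rw [le_bot_iff.1 h8, finrank_bot]
      exact Nat.zero_le _
  obtain ⟨C, hC⟩ := hA.2.1
  -- No bound on `M x` itself is needed: the combined vectors are controlled by the norm of the
  -- operator they factor.
  have hbound : ∀ᵐ x ∂torusMeasure k, ∀ j, ‖combine (M x) (fibers φ x) j‖ ≤ Real.sqrt C := by
    filter_upwards [hkey, hC] with x h1 h2 j
    refine Real.le_sqrt_of_sq_le ((norm_sq_le_norm_pairOp _ j).trans ?_)
    rwa [h1.1]
  have hmem : ∀ j, MemLp (fun x => combine (M x) (fibers φ x) j) 2 (torusMeasure k) := fun j => by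
    refine MemLp.of_bound (Finset.aestronglyMeasurable_fun_sum _ fun i _ => ?_) (Real.sqrt C) ?_
    · exact (hMmeas i j).aestronglyMeasurable.smul (aestronglyMeasurable_fiber (φ i))
    · filter_upwards [hbound] with x hx using hx j
  choose r hr using fun j => exists_fiber_eq (hmem j)
  have hfib : ∀ᵐ x ∂torusMeasure k, fibers r x = combine (M x) (fibers φ x) := by
    filter_upwards [ae_all_iff.2 hr] with x hx
    exact funext hx
  have hrB : IsBessel (translates r) := isBessel_translates fun j => ⟨Real.sqrt C, by
    filter_upwards [hfib, hbound] with x h1 h2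
    have := h2 j
    rwa [← h1] at this⟩
  have hrF : mixedOperator r F = 0 := by
    refine (isFiberField_mixedOperator hrB hS.bessel_left).operator_eq IsFiberField.zero ?_
    filter_upwards [hfib, hkey] with x h1 h2
    rw [h1, h2.2]
  have hrr : mixedOperator r r = A := by
    refine (isFiberField_mixedOperator hrB hrB).operator_eq hA ?_
    filter_upwards [hfib, hkey] with x h1 h2
    rw [h1, h2.1]
  have hrV : ∀ i, r i ∈ V := fun i => by
    rw [mem_iff_ae_fiber_mem_fiberSpan hS.bessel_right hS.bessel_aux hS.mixed_orthProj
      hS.mem_right]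
    filter_upwards [hr i] with x hx
    rw [hx]
    exact Submodule.sum_mem _ fun j _ =>
      Submodule.smul_mem _ _ (Submodule.subset_span (Set.mem_range_self j))
  obtain ⟨hGB, hGS⟩ := hS.frameOperator_sub hrB hrF
  have hGV : ∀ i, φ i - r i ∈ V := fun i => V.toSubmodule.sub_mem (hS.mem_right i) (hrV i)
  refine ⟨fun i => φ i - r i, ⟨hGV, fun p => hS.shiftInvariant p.1 _ (hGV p.2), hGB,
    fun h hh => ?_⟩, ?_⟩
  · have hGF : mixedOperator (fun i => φ i - r i) F = Q := by
      rw [mixedOperator, translates_sub, hS.bessel_right.synthesis_sub hrB, sub_comp]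
      change mixedOperator φ F - mixedOperator r F = Q
      rw [hS.mixed_projection, hrF, sub_zero]
    have hFG : mixedOperator F (fun i => φ i - r i) h = h := by
      rw [← adjoint_mixedOperator, hGF, hS.adjoint_projection_of_mem hh]
    have := hS.bessel_left.hasSum_synthesis
      (adjoint (synthesis (translates fun i => φ i - r i)) h)
    simp only [hGB.adjoint_synthesis_apply] at this
    change HasSum _ (mixedOperator F (fun i => φ i - r i) h) at this
    rwa [hFG] at this
  · rw [IsTight, hGS, ← mixedOperator_self r, hrr, hAdef]
    abel

end IsCanonicalSystem

theorem canonicalObliqueDual_translates {V W : ClosedSubmodule ℂ (L2 k)}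
    (hV : IsShiftInvariant V) (hW : IsShiftInvariant W)
    (hVW : IsCompl V.toSubmodule W.toSubmoduleᗮ) {F : Fin n → L2 k}
    (hF : IsFrameFor W (translates F)) :
    ∃ (Q : L2 k →L[ℂ] L2 k) (φ θ F' : Fin n → L2 k), IsCanonicalSystem V W Q F φ θ F' ∧
      canonicalObliqueDual V W hVW (translates F) = translates φ := by
  have htop : Submodule.IsTopCompl V.toSubmodule W.toSubmoduleᗮ :=
    Submodule.IsCompl.isTopCompl_of_isClosed hVW V.isClosed (Submodule.isClosed_orthogonal _)
  let Q : L2 k →L[ℂ] L2 k := Submodule.projectionL _ _ htop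
  have hQ : ∀ h, Q h = Submodule.projection V.toSubmodule W.toSubmoduleᗮ hVW h := fun h => rfl
  have hQV : ∀ h, Q h ∈ V := fun h => Submodule.projection_apply_mem hVW h
  have hQV' : ∀ h ∈ V, Q h = h := fun h hh => Submodule.projection_apply_of_mem_left hVW hh
  have hQW : ∀ h ∈ W.toSubmoduleᗮ, Q h = 0 := fun h hh =>
    (Submodule.projection_apply_eq_zero_iff hVW).2 hh
  have hQs : ∀ h, h - Q h ∈ W.toSubmoduleᗮ := fun h => Submodule.sub_projection_mem hVW h
  have hQT : IsShiftPreserving Q := fun l h => by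
    have h1 : translate l (h - Q h) ∈ W.toSubmoduleᗮ :=
      hW.translate_mem_orthogonal l (hQs h)
    have h2 := hQW _ h1
    rw [translate_sub, map_sub, sub_eq_zero, hQV' _ (hV l _ (hQV h))] at h2
    exact h2
  have hBT := isShiftPreserving_pseudoInverse hW hF
  obtain ⟨h1, h2, h3⟩ := hF.pseudoInverse_spec
  have hFB := hF.isBessel
  set S := frameOperator (translates F) with hSdef
  set B := pseudoInverse S with hB
  -- This yields `T_φ T_F* = Q B S = Q P_W = Q`, and then `T_φ T_θ* = Q P_V = P_V` for `θ = P_V F`.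
  have hQP : Q ∘L orthProj W = Q := by
    ext1 h
    have := hQW _ (Submodule.sub_starProjection_mem_orthogonal (K := W.toSubmodule) h)
    rw [map_sub, sub_eq_zero] at this
    exact this.symm
  have hφ : translates (fun i => Q (B (F i))) = fun p => (Q ∘L B) (translates F p) := by
    rw [hQT.translates_map (fun i => B (F i)), hBT.translates_map F]; rfl
  have hθ := hV.orthProj.translates_map F
  have hFW : ∀ i, F i ∈ W := fun i => by
    have := hF.1 (0, i)
    rwa [translates, translate_zero] at this
  have hmix : mixedOperator (fun i => Q (B (F i))) F = Q := by
    rw [mixedOperator, hφ, hFB.synthesis_map, comp_assoc]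
    change (Q ∘L B) ∘L S = Q
    rw [comp_assoc, h2, hQP]
  refine ⟨Q, fun i => Q (B (F i)), fun i => orthProj V (F i), fun i => B (F i), ?_, ?_⟩
  · exact
      { shiftInvariant := hV
        projection_of_mem := hQV'
        projection_of_mem_orthogonal := hQW
        sub_projection_mem := hQs
        mem_left := hF.1
        mem_right := fun i => hQV _
        bessel_left := hFB
        bessel_right := by rw [hφ]; exact hFB.map _
        bessel_aux := by rw [hθ]; exact hFB.map _
        mixed_projection := hmix
        mixed_orthProj := by
          rw [mixedOperator, hθ, hFB.synthesis_map, adjoint_comp, adjoint_orthProj, ← comp_assoc]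
          change mixedOperator (fun i => Q (B (F i))) F ∘L orthProj V = orthProj V
          rw [hmix]
          ext1 h
          exact hQV' _ (orthProj_mem V h)
        mixed_dual := fun i => by
          change (S ∘L B) (F i) = F i
          rw [h1, orthProj_eq_self_iff.2 (hFW i)]
        exists_map := ⟨Q ∘L B, by rw [hφ, hFB.synthesis_map]⟩ }
  · rw [hφ]; rfl

end TightDuals

end ObliqueDuals

end

theorem mainTheorem6 (k n : ℕ)
    (V W : ClosedSubmodule ℂ (ObliqueDuals.L2 k))
    (hV : ObliqueDuals.IsFSI V) (hW : ObliqueDuals.IsFSI W)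
    (hVW : IsCompl V.toSubmodule W.toSubmoduleᗮ)
    (F : Fin n → ObliqueDuals.L2 k)
    (hF : ObliqueDuals.IsFrameFor W (ObliqueDuals.translates F))
    (c : ℝ) :
    (∃ G : Fin n → ObliqueDuals.L2 k,
        ObliqueDuals.IsSGDual V W F G ∧ ObliqueDuals.IsTight V c G) ↔
      (ObliqueDuals.frameOperator
          (ObliqueDuals.canonicalObliqueDual V W hVW (ObliqueDuals.translates F)) ≤
        (c : ℂ) • ObliqueDuals.orthProj V) ∧
      ∀ᵐ x ∂ObliqueDuals.torusMeasure k, x ∈ ObliqueDuals.spec V →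
        LinearMap.rank
            (ObliqueDuals.fiberOperator
              ((c : ℂ) • ObliqueDuals.orthProj V -
                ObliqueDuals.frameOperator
                  (ObliqueDuals.canonicalObliqueDual V W hVW (ObliqueDuals.translates F)))
              x).toLinearMap ≤
          ((min (ObliqueDuals.fiberDim V x) (n - ObliqueDuals.fiberDim V x) : ℕ) :
            Cardinal) := by
  obtain ⟨Q, φ, θ, F', hS, hφ⟩ := ObliqueDuals.canonicalObliqueDual_translates
    hV.isShiftInvariant hW.isShiftInvariant hVW hF
  rw [hφ]
  exact ⟨fun ⟨G, hG, hT⟩ => hS.isPositive_and_rank_of_isTight hG hT,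
    fun ⟨h1, h2⟩ => hS.exists_isTight_of_rank h1 h2⟩
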